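/- Let $d\ge 0$, let $\Theta\subset\mathbb R^d$ be open and connected, let $(P_\theta)_{\theta\in\Theta}$ be probability measures on a measurable space $(\mathcal X,\mathcal B)$, where $\mathcal X$ also carries a $\sigma$-compact topology, let $g:\mathcal X\times\Theta\to\mathbb R^d$ have $g(\cdot,\theta)$ measurable for every $\theta$, and let $p:\mathcal X\to\mathbb R^d$ be measurable. Write $E_\theta$ for expectation under $P_\theta$, $X$ for the identity of $\mathcal X$, $J_\theta$ for the Jacobian matrix in $\theta$, $'$ for transposition, and $L_{\theta,\theta'}$ for the likelihood ratio of $P_{\theta'}$ with respect to $P_\theta$ (the density of the absolutely continuous part). Assume that every $\theta_1\in\Theta$ has the following properties. 1. The family is $L^2$-differentiable at $\theta_1$: $P_\theta\ll P_{\theta_1}$ for all $\theta$ in a neighbourhood of $\theta_1$, and there is $\dot L_{\theta_1}\in L^2(P_{\theta_1};\mathbb R^d)$ with $E_{\theta_1}\big(L_{\theta_1,\theta_1+u}^{1/2}-1-\tfrac12u'\dot L_{\theta_1}\big)^2=o(\|u\|^2)$ as $u\to0$. 2. The Fisher information matrix $I(\theta_1)=E_{\theta_1}\big(\dot L_{\theta_1}\dot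 L_{\theta_1}'\big)$ is invertible. 3. There is a neighbourhood $U\subset\Theta$ of $\theta_1$ such that for each $\theta\in U$, for $P_\theta$-almost every $x$, $g(x,\cdot)$ is differentiable at all points of $U$; moreover $\sup_{\theta,\theta'\in U}E_\theta\|J_\theta g(X,\theta')\|^2<\infty$ and $\sup_{\theta,\theta'\in U}E_\theta L_{\theta,\theta'}^2<\infty$. 4. There is a neighbourhood $V\subset\Theta$ of $\theta_1$ with $\sup_{\theta\in V}E_\theta\|p(X)\|^2<\infty$. Put $G(\theta)=E_\theta J_\theta g(X,\theta)$ and assume further: 5. $p$ is unbiased: $p(X)$ and $g(X,\theta)$ are $P_\theta$-integrable and $E_\theta p(X)=E_\theta g(X,\theta)$ for all $\theta\in\Theta$; 6. $p$ is efficient: for all $\theta\in\Theta$, $E_\theta\|p(X)-g(X,\theta)\|^2<\infty$ and $E_\theta\big[(p(X)-g(X,\theta))(p(X)-g(X,\theta))'\big]=G(\theta)I(\theta)^{-1}G(\theta)'$; 7. $G(\theta)$ is invertible for all $\theta\in\Theta$, and $\theta\mapsto I(\theta)$ and $\theta\mapsto G(\theta)$ are continuous on $\Theta$; 8. $A:\Theta\to\mathbb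 R^d$ is differentiable with $(J_\theta A(\theta))'=I(\theta)G(\theta)^{-1}$ for all $\theta\in\Theta$; 9. for all compact $C\subset\mathcal X$ and $\tilde C\subset\Theta$, $\|J_\theta g(x,\theta)\|$ is bounded over those $(x,\theta)\in C\times\tilde C$ at which the Jacobian exists. Then for every $\theta_0\in\Theta$ there is a function $B:\mathcal X\times\Theta\to\mathbb R$, with $B(x,\cdot)$ differentiable on $\Theta$ for every $x$, such that for all $\theta\in\Theta$ we have $P_\theta\ll P_{\theta_0}$ and, for $P_{\theta_0}$-almost all $x$, $$\frac{dP_\theta}{dP_{\theta_0}}(x)=\exp\big(A(\theta)'p(x)-B(x,\theta)\big),$$ and such that, for $P_{\theta_0}$-almost all $x$, $\nabla_\theta B(x,\theta)=(J_\theta A(\theta))'g(x,\theta)$ for all $\theta\in\Theta$. -/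

import Mathlib

open MeasureTheory Filter Topology Asymptotics
open scoped ENNReal Matrix RealInnerProductSpace

namespace Prediction

/-- The Euclidean space `ℝⁿ`. -/
abbrev Euc (n : ℕ) : Type := EuclideanSpace ℝ (Fin n)

noncomputable section

/-- The Jacobian matrix of `f : ℝᵈ → ℝᵏ` at `θ` (meaningful where `f` is differentiable). -/
def jacobian {d k : ℕ} (f : Euc d → Euc k) (θ : Euc d) : Matrix (Fin k) (Fin d) ℝ :=
  Matrix.of fun i j => fderiv ℝ f θ (EuclideanSpace.single j 1) i

variable {X : Type*} [MeasurableSpace X] {d k : ℕ}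

/-- The likelihood ratio `L_{θ₀,θ}` of `P θ` with respect to `P θ₀`: the density of the absolutely
continuous part. A version that takes the value `∞` on a set carrying the singular part differs
from it only on a `P θ₀`-null set, and it is only ever integrated against `P θ₀`. -/
def likelihoodRatio (P : Euc d → Measure X) (θ₀ θ : Euc d) : X → ℝ≥0∞ :=
  (P θ).rnDeriv (P θ₀)

/-- The family `(P θ, θ ∈ Θ)` is `L²`-differentiable at `θ₀` (an interior point of `Θ`), with
derivative `ℓ ∈ L²(P θ₀; ℝᵈ)`. -/
structure HasL2DerivAt (P : Euc d → Measure X) (Θ : Set (Euc d)) (θ₀ : Euc d)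
    (ℓ : X → Euc d) : Prop where
  absolutelyContinuous : ∃ U ∈ 𝓝 θ₀, U ⊆ Θ ∧ ∀ θ ∈ U, P θ ≪ P θ₀
  memLp : MemLp ℓ 2 (P θ₀)
  isLittleO :
    (fun u : Euc d =>
      ∫ x, (√(likelihoodRatio P θ₀ (θ₀ + u) x).toReal - 1 - (1 / 2) * ⟪u, ℓ x⟫) ^ 2 ∂(P θ₀))
      =o[𝓝 0] fun u => ‖u‖ ^ 2

/-- The Fisher information matrix `I(θ) = E_θ (ℓ_θ ℓ_θ')`, where `ℓ θ` is the `L²`-derivative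
at `θ`. -/
def fisherInfo (P : Euc d → Measure X) (ℓ : Euc d → X → Euc d) (θ : Euc d) :
    Matrix (Fin d) (Fin d) ℝ :=
  Matrix.of fun i j => ∫ x, ℓ θ x i * ℓ θ x j ∂(P θ)

/-- The matrix `G(θ) = E_θ J_θ g(X, θ)`. -/
def meanJacobian (P : Euc d → Measure X) (g : X → Euc d → Euc k) (θ : Euc d) :
    Matrix (Fin k) (Fin d) ℝ :=
  Matrix.of fun i j => ∫ x, jacobian (g x) θ i j ∂(P θ)

/-- The quadratic error of prediction `R(θ) = E_θ (p(X) - g(X,θ)) (p(X) - g(X,θ))'`. -/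
def quadraticError (P : Euc d → Measure X) (g : X → Euc d → Euc k) (p : X → Euc k)
    (θ : Euc d) : Matrix (Fin k) (Fin k) ℝ :=
  Matrix.of fun i j => ∫ x, (p x - g x θ) i * (p x - g x θ) j ∂(P θ)

/-- The regularity assumption at the point `θ₀` under which the Cramér-Rao inequality for
prediction is considered. -/
structure RegularAt (P : Euc d → Measure X) (Θ : Set (Euc d)) (ℓ : Euc d → X → Euc d)
    (g : X → Euc d → Euc k) (p : X → Euc k) (θ₀ : Euc d) : Prop where
  hasL2DerivAt : HasL2DerivAt P Θ θ₀ (ℓ θ₀)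
  fisherInfo_isUnit : IsUnit (fisherInfo P ℓ θ₀)
  exists_nhds : ∃ U ∈ 𝓝 θ₀, U ⊆ Θ ∧
    (∀ θ ∈ U, ∀ᵐ x ∂(P θ), ∀ θ' ∈ U, DifferentiableAt ℝ (g x) θ') ∧
    (⨆ θ ∈ U, ⨆ θ' ∈ U, ∫⁻ x, ‖fderiv ℝ (g x) θ'‖ₑ ^ 2 ∂(P θ)) < ∞ ∧
    (⨆ θ ∈ U, ⨆ θ' ∈ U, ∫⁻ x, likelihoodRatio P θ θ' x ^ 2 ∂(P θ)) < ∞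
  exists_nhds_predictor : ∃ U ∈ 𝓝 θ₀, U ⊆ Θ ∧ (⨆ θ ∈ U, ∫⁻ x, ‖p x‖ₑ ^ 2 ∂(P θ)) < ∞

/-- `p(X)` is an unbiased predictor of `g(X, θ)`. -/
def IsUnbiased (P : Euc d → Measure X) (Θ : Set (Euc d)) (g : X → Euc d → Euc k)
    (p : X → Euc k) : Prop :=
  ∀ θ ∈ Θ, Integrable p (P θ) ∧ Integrable (fun x => g x θ) (P θ) ∧
    ∫ x, p x ∂(P θ) = ∫ x, g x θ ∂(P θ)

/-- `p(X)` is an efficient predictor of `g(X, θ)`: its quadratic error of prediction is finite and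
equals the Cramér-Rao bound `G(θ) I(θ)⁻¹ G(θ)'` at every parameter. -/
def IsEfficient (P : Euc d → Measure X) (Θ : Set (Euc d)) (ℓ : Euc d → X → Euc d)
    (g : X → Euc d → Euc k) (p : X → Euc k) : Prop :=
  ∀ θ ∈ Θ, MemLp (fun x => p x - g x θ) 2 (P θ) ∧
    quadraticError P g p θ =
      meanJacobian P g θ * (fisherInfo P ℓ θ)⁻¹ * (meanJacobian P g θ)ᵀ

end

end Prediction

/-! Efficiency is equality in the Cramér–Rao inequality, and equality forces the score to be a
linear image of the prediction error. Differentiating `E_θ (p - g(·, θ₁)) = E_θ (g(·, θ) - g(·,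
θ₁))` at `θ₁` gives `E (p - g) ℓ' = G` (`integral_error_mul_score_eq_meanJacobian`). With `E (p -
g)(p - g)' = G I⁻¹ G'` this makes the second moment of each coordinate of `p - g - G I⁻¹ ℓ` vanish,
so `ℓ = I G⁻¹ (p - g) = (J A)' (p - g)` almost surely (`score_eq_of_isEfficient`). For almost all
`x` this version of the score is continuous in `θ`.

It remains to integrate the score. `L²`-differentiability says nothing about individual paths of the
likelihood, so the integration takes place in `L¹`: along a segment the root density solves the
linear equation `s' = f s`, where `f` is half the inner product of the direction with the score, and
the only solution is `s₀ exp ∫ f` (`ae_eq_mul_exp_of_L1_hasDeriv`,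
`rootDensity_eq_mul_exp_segment`). Exponentials are positive, so nearby measures are mutually
absolutely continuous; connectedness spreads this over `Θ`, and increments of the log-likelihood
over segments in `Θ` become line integrals of the score.

These identities hold off null sets that depend on the endpoints. On a countable dense set of
parameters they hold simultaneously, and continuity of the score extends the log-likelihood from
there to a potential on all of `Θ` (`potential_of_dense`). Subtracting the potential from `A' p`
leaves `B`, with gradient `(J A)' p - (J A)' (p - g) = (J A)' g`. -/

namespace Prediction

/-! ### Weak convergence in `L²` and differentiation of an expectation -/

section WeakConvergence

variable {X : Type*} [MeasurableSpace X] {μ : Measure X}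

/-- The Cauchy–Schwarz inequality for real functions, in terms of `eLpNorm`. -/
lemma eLpNorm_one_mul_le {f g : X → ℝ} (hf : AEStronglyMeasurable f μ)
    (hg : AEStronglyMeasurable g μ) :
    eLpNorm (fun x => f x * g x) 1 μ ≤ eLpNorm f 2 μ * eLpNorm g 2 μ := by
  have := eLpNorm_smul_le_mul_eLpNorm (p := 2) (q := 2) (r := 1) hg hf
  simpa [Pi.smul_def, Pi.mul_def] using this

lemma memLp_two_of_eLpNorm_le {f : X → ℝ} {C : ℝ≥0∞} (hC : C ≠ ∞)
    (hf : AEStronglyMeasurable f μ) (h : eLpNorm f 2 μ ≤ C) : MemLp f 2 μ :=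
  ⟨hf, h.trans_lt hC.lt_top⟩

lemma tendsto_integral_mul_of_eLpNorm_le_of_tendsto_eLpNorm {a b : ℕ → X → ℝ} {C : ℝ≥0∞}
    (hC : C ≠ ∞) (ha : ∀ n, AEStronglyMeasurable (a n) μ) (haC : ∀ n, eLpNorm (a n) 2 μ ≤ C)
    (hb : ∀ n, MemLp (b n) 2 μ)
    (h0 : Tendsto (fun n => eLpNorm (b n) 2 μ) atTop (𝓝 0)) :
    Tendsto (fun n => ∫ x, a n x * b n x ∂μ) atTop (𝓝 0) := by
  have key : Tendsto (fun n => eLpNorm (fun x => a n x * b n x) 1 μ) atTop (𝓝 0) := by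
    have h1 : Tendsto (fun n => C * eLpNorm (b n) 2 μ) atTop (𝓝 0) := by
      simpa using ENNReal.Tendsto.const_mul h0 (Or.inr hC)
    refine tendsto_of_tendsto_of_tendsto_of_le_of_le tendsto_const_nhds h1 (fun _ => zero_le) ?_
    intro n
    exact (eLpNorm_one_mul_le (ha n) (hb n).1).trans (mul_le_mul' (haC n) le_rfl)
  have := tendsto_integral_of_L1' (μ := μ) (fun _ => (0 : ℝ)) aestronglyMeasurable_const
    (F := fun n x => a n x * b n x) (l := atTop)
    (Eventually.of_forall fun n =>
      (memLp_two_of_eLpNorm_le hC (ha n) (haC n)).integrable_mul (hb n))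
    (by simpa [Pi.sub_def] using key)
  simpa using this

/-- A sequence bounded in `L²` that tends to zero almost everywhere tends to zero weakly. -/
lemma tendsto_integral_mul_of_eLpNorm_le_of_tendsto_ae [IsFiniteMeasure μ] {a : ℕ → X → ℝ}
    {b : X → ℝ} {C : ℝ≥0∞} (hC : C ≠ ∞) (ha : ∀ n, AEStronglyMeasurable (a n) μ)
    (haC : ∀ n, eLpNorm (a n) 2 μ ≤ C)
    (h0 : ∀ᵐ x ∂μ, Tendsto (fun n => a n x) atTop (𝓝 0)) (hb : MemLp b 2 μ) :
    Tendsto (fun n => ∫ x, a n x * b x ∂μ) atTop (𝓝 0) := by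
  have hmeas : ∀ n, AEStronglyMeasurable (fun x => a n x * b x) μ := fun n => (ha n).mul hb.1
  -- Uniform integrability comes from `b` alone: by Cauchy–Schwarz the integral over a small set is
  -- at most `C` times the small `L²` norm of `b` there. Vitali's theorem then applies. The `+ 1` in
  -- the denominator covers `C = 0`.
  have hui : UnifIntegrable (fun n x => a n x * b x) 1 μ := by
    intro ε hε
    obtain ⟨δ, hδ, h⟩ := hb.eLpNorm_indicator_le (by norm_num) (by norm_num)
      (ε := ε / (C.toReal + 1)) (by positivity)
    refine ⟨δ, hδ, fun n s hs hμ => ?_⟩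
    have e : s.indicator (fun x => a n x * b x) = fun x => a n x * s.indicator b x := by
      ext x; by_cases hx : x ∈ s <;> simp [hx]
    rw [e]
    refine (eLpNorm_one_mul_le (ha n) (hb.1.indicator hs)).trans ?_
    calc _ ≤ C * ENNReal.ofReal (ε / (C.toReal + 1)) := by
          gcongr
          exacts [haC n, h s hs hμ]
      _ = ENNReal.ofReal (C.toReal * (ε / (C.toReal + 1))) := by
          rw [ENNReal.ofReal_mul ENNReal.toReal_nonneg, ENNReal.ofReal_toReal hC]
      _ ≤ ENNReal.ofReal ε := by
          apply ENNReal.ofReal_le_ofReal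
          have : 0 ≤ C.toReal := ENNReal.toReal_nonneg
          rw [mul_div_assoc', div_le_iff₀ (by positivity)]
          nlinarith
  have hlim := tendsto_Lp_finite_of_tendsto_ae (g := fun _ => (0 : ℝ)) le_rfl (by norm_num)
    hmeas (by simp) hui (by
      filter_upwards [h0] with x hx
      simpa using hx.mul_const (b x))
  have := tendsto_integral_of_L1' (μ := μ) (fun _ => (0 : ℝ)) aestronglyMeasurable_const
    (F := fun n x => a n x * b x) (l := atTop)
    (Eventually.of_forall fun n =>
      (memLp_two_of_eLpNorm_le hC (ha n) (haC n)).integrable_mul hb) hlim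
  simpa using this

/-- Differentiation of the identity `∫ (a - t q) S² = 0` at `t = 0`, along a sequence `t n → 0`,
when the root densities `S n` satisfy `S n = 1 + t n * l / 2 + o(t n)` in `L²`. -/
lemma integral_mul_score_eq_of_root_expansion [IsFiniteMeasure μ] {S q : ℕ → X → ℝ}
    {a l D : X → ℝ} {t : ℕ → ℝ} {C : ℝ≥0∞} (hC : C ≠ ∞) (ht : ∀ n, t n ≠ 0)
    (hSL : ∀ n, MemLp (S n) 2 μ) (hl : MemLp l 2 μ) (haL : MemLp a 2 μ)
    (hS1 : Tendsto (fun n => eLpNorm (fun x => S n x - 1) 2 μ) atTop (𝓝 0))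
    (hexp : Tendsto (fun n => eLpNorm (fun x => (S n x - 1) / t n - 1 / 2 * l x) 2 μ)
      atTop (𝓝 0))
    (hSae : ∀ᵐ x ∂μ, Tendsto (fun n => S n x) atTop (𝓝 1))
    (haS : ∀ n, eLpNorm (fun x => a x * S n x) 2 μ ≤ C)
    (hqm : ∀ n, AEStronglyMeasurable (q n) μ)
    (hq : ∀ n, eLpNorm (q n) 2 μ ≤ C)
    (hqS : ∀ n, eLpNorm (fun x => q n x * S n x) 2 μ ≤ C)
    (hqae : ∀ᵐ x ∂μ, Tendsto (fun n => q n x) atTop (𝓝 (D x)))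
    (ha0 : ∫ x, a x ∂μ = 0)
    (hid : ∀ n, ∫ x, a x * S n x ^ 2 ∂μ = t n * ∫ x, q n x * S n x ^ 2 ∂μ) :
    ∫ x, a x * l x ∂μ = ∫ x, D x ∂μ := by
  -- The limit `D` inherits the `L²` bound of the quotients by Fatou's lemma.
  have hDm : AEStronglyMeasurable D μ := aestronglyMeasurable_of_tendsto_ae atTop hqm hqae
  have hDC : eLpNorm D 2 μ ≤ C := by
    refine (Lp.eLpNorm_lim_le_liminf_eLpNorm hqm D hqae).trans ?_
    exact (liminf_le_liminf (Eventually.of_forall hq)).trans (by simp)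
  have hD : MemLp D 2 μ := memLp_two_of_eLpNorm_le hC hDm hDC
  have hqL : ∀ n, MemLp (q n) 2 μ := fun n => memLp_two_of_eLpNorm_le hC (hqm n) (hq n)
  have haSm : ∀ n, AEStronglyMeasurable (fun x => a x * S n x) μ := fun n => haL.1.mul (hSL n).1
  have hqSm : ∀ n, AEStronglyMeasurable (fun x => q n x * S n x) μ :=
    fun n => (hqm n).mul (hSL n).1
  have haSL : ∀ n, MemLp (fun x => a x * S n x) 2 μ :=
    fun n => memLp_two_of_eLpNorm_le hC (haSm n) (haS n)
  have hqSL : ∀ n, MemLp (fun x => q n x * S n x) 2 μ :=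
    fun n => memLp_two_of_eLpNorm_le hC (hqSm n) (hqS n)
  have hS1L : ∀ n, MemLp (fun x => S n x - 1) 2 μ := fun n => (hSL n).sub (memLp_const 1)
  have hRL : ∀ n, MemLp (fun x => (S n x - 1) / t n - 1 / 2 * l x) 2 μ := fun n => by
    refine MemLp.sub ?_ (hl.const_mul _)
    simpa [div_eq_inv_mul] using (hS1L n).const_mul (t n)⁻¹
  set C' : ℝ≥0∞ := C + eLpNorm a 2 μ with hC'
  have hC't : C' ≠ ∞ := by simp [hC', hC, haL.2.ne]
  -- the error terms
  have e1 : Tendsto (fun n => ∫ x, (a x * S n x + a x) * ((S n x - 1) / t n - 1 / 2 * l x) ∂μ)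
      atTop (𝓝 0) := by
    refine tendsto_integral_mul_of_eLpNorm_le_of_tendsto_eLpNorm hC't
      (fun n => (haSm n).add haL.1) (fun n => ?_) hRL hexp
    refine (eLpNorm_add_le (haSm n) haL.1 (by norm_num)).trans ?_
    exact add_le_add (haS n) le_rfl
  -- No `L²` convergence of `a * S n` to `a` is available, only boundedness and almost everywhere
  -- convergence; against the fixed function `l` that suffices.
  have e2 : Tendsto (fun n => ∫ x, (a x * S n x - a x) * l x ∂μ) atTop (𝓝 0) := by
    refine tendsto_integral_mul_of_eLpNorm_le_of_tendsto_ae hC't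
      (fun n => (haSm n).sub haL.1) (fun n => ?_) ?_ hl
    · refine (eLpNorm_sub_le (haSm n) haL.1 (by norm_num)).trans ?_
      exact add_le_add (haS n) le_rfl
    · filter_upwards [hSae] with x hx
      simpa using (hx.const_mul (a x)).sub_const (a x)
  have e3 : Tendsto (fun n => ∫ x, (q n x * S n x + q n x) * (S n x - 1) ∂μ) atTop (𝓝 0) := by
    refine tendsto_integral_mul_of_eLpNorm_le_of_tendsto_eLpNorm (C := C + C) (by simp [hC])
      (fun n => (hqSm n).add (hqm n)) (fun n => ?_) hS1L hS1
    exact (eLpNorm_add_le (hqSm n) (hqm n) (by norm_num)).trans (add_le_add (hqS n) (hq n))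
  have e4 : Tendsto (fun n => ∫ x, (q n x - D x) * 1 ∂μ) atTop (𝓝 0) := by
    refine tendsto_integral_mul_of_eLpNorm_le_of_tendsto_ae (C := C + C) (by simp [hC])
      (fun n => (hqm n).sub hDm) (fun n => ?_) ?_ (memLp_const 1)
    · exact (eLpNorm_sub_le (hqm n) hDm (by norm_num)).trans (add_le_add (hq n) hDC)
    · filter_upwards [hqae] with x hx
      simpa using hx.sub_const (D x)
  -- Both sides of `hid`, divided by `t n`, are expanded with `S² - 1 = (S + 1)(S - 1)`: the left is
  -- `∫ a l` plus the errors of `e1` and half of `e2`, the right is `∫ D` plus the errors of `e3`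
  -- and `e4`.
  have main : ∀ n, ∫ x, a x * l x ∂μ - ∫ x, D x ∂μ =
      ∫ x, (q n x * S n x + q n x) * (S n x - 1) ∂μ + ∫ x, (q n x - D x) * 1 ∂μ
      - ∫ x, (a x * S n x + a x) * ((S n x - 1) / t n - 1 / 2 * l x) ∂μ
      - 1 / 2 * ∫ x, (a x * S n x - a x) * l x ∂μ := by
    intro n
    have i1 : Integrable (fun x => (q n x * S n x + q n x) * (S n x - 1)) μ :=
      ((hqSL n).add (hqL n)).integrable_mul (hS1L n)
    have i2 : Integrable (fun x => (q n x - D x) * 1) μ := by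
      simp only [mul_one]
      exact ((hqL n).sub hD).integrable (by norm_num)
    have i3 : Integrable
        (fun x => (a x * S n x + a x) * ((S n x - 1) / t n - 1 / 2 * l x)) μ :=
      ((haSL n).add haL).integrable_mul (hRL n)
    have i4 : Integrable (fun x => (a x * S n x - a x) * l x) μ :=
      ((haSL n).sub haL).integrable_mul hl
    have i5 : Integrable (fun x => a x * l x) μ := haL.integrable_mul hl
    have i6 : Integrable D μ := hD.integrable (by norm_num)
    have i7 : Integrable (fun x => a x * S n x ^ 2) μ := by
      refine ((haSL n).integrable_mul (hSL n)).congr (Eventually.of_forall fun x => ?_)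
      simp only [Pi.mul_apply]; ring
    have i8 : Integrable a μ := haL.integrable (by norm_num)
    have h1 : ∫ x, q n x * S n x ^ 2 ∂μ =
        ∫ x, (q n x * S n x + q n x) * (S n x - 1) ∂μ + ∫ x, (q n x - D x) * 1 ∂μ
          + ∫ x, D x ∂μ := by
      have i12 : Integrable
          (fun x => (q n x * S n x + q n x) * (S n x - 1) + (q n x - D x) * 1) μ := i1.add i2
      rw [← integral_add i1 i2, ← integral_add i12 i6]
      congr 1; ext x; ring
    have h2 : (t n)⁻¹ * (∫ x, a x * S n x ^ 2 ∂μ - ∫ x, a x ∂μ) =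
        ∫ x, (a x * S n x + a x) * ((S n x - 1) / t n - 1 / 2 * l x) ∂μ
          + 1 / 2 * ∫ x, (a x * S n x - a x) * l x ∂μ + ∫ x, a x * l x ∂μ := by
      have i34 : Integrable (fun x => (a x * S n x + a x) * ((S n x - 1) / t n - 1 / 2 * l x)
          + 1 / 2 * ((a x * S n x - a x) * l x)) μ := i3.add (i4.const_mul _)
      rw [← integral_sub i7 i8, ← integral_const_mul, ← integral_const_mul,
        ← integral_add i3 (i4.const_mul _), ← integral_add i34 i5]
      congr 1; ext x; ring
    rw [ha0, hid n, sub_zero, inv_mul_cancel_left₀ (ht n), h1] at h2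
    linarith
  have hlim := ((e3.add e4).sub e1).sub (e2.const_mul (1 / 2))
  have := tendsto_nhds_unique (tendsto_const_nhds.congr main) hlim
  linarith

end WeakConvergence

end Prediction

/-! ### Mean value inequality and linear differential equations in `L¹` -/

namespace Prediction

section Paths

variable {X : Type*} [MeasurableSpace X]

/-- An `L²` mean value inequality for a process with differentiable paths on `[0, 1]`. -/
lemma lintegral_sub_sq_le_of_hasDerivAt {ν : Measure X} [SFinite ν] {φ φ' : ℝ → X → ℝ}
    {K : ℝ≥0∞} (hφ : ∀ s ∈ Set.Icc (0 : ℝ) 1, Measurable (φ s))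
    (hderiv : ∀ᵐ x ∂ν, ∀ s ∈ Set.Icc (0 : ℝ) 1, HasDerivAt (fun s => φ s x) (φ' s x) s)
    (hbdd : ∀ᵐ x ∂ν, ∃ M : ℝ, ∀ s ∈ Set.Icc (0 : ℝ) 1, |φ' s x| ≤ M)
    (hK : ∀ s ∈ Set.Icc (0 : ℝ) 1, ∫⁻ x, ‖φ' s x‖ₑ ^ 2 ∂ν ≤ K) :
    ∫⁻ x, ‖φ 1 x - φ 0 x‖ₑ ^ 2 ∂ν ≤ K := by
  obtain ⟨Z, hZsub, hZm, hZν⟩ : ∃ Z, {x | ¬ ((∀ s ∈ Set.Icc (0 : ℝ) 1,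
      HasDerivAt (fun s => φ s x) (φ' s x) s) ∧ ∃ M : ℝ, ∀ s ∈ Set.Icc (0 : ℝ) 1,
      |φ' s x| ≤ M)} ⊆ Z ∧ MeasurableSet Z ∧ ν Z = 0 :=
    exists_measurable_superset_of_null (hderiv.and hbdd)
  have hgood : ∀ x ∉ Z, (∀ s ∈ Set.Icc (0 : ℝ) 1,
      HasDerivAt (fun s => φ s x) (φ' s x) s) ∧ ∃ M : ℝ, ∀ s ∈ Set.Icc (0 : ℝ) 1,
      |φ' s x| ≤ M := fun x hx => by
    by_contra h
    exact hx (hZsub h)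
  -- Clamping time to `[0, 1]` and cutting off the null set makes every path continuous, which gives
  -- joint measurability.
  let ψ : ℝ → X → ℝ := fun s => Zᶜ.indicator (φ (Set.projIcc 0 1 zero_le_one s))
  have hψm : Measurable (Function.uncurry ψ) := by
    refine measurable_uncurry_of_continuous_of_measurable (fun x => ?_) (fun s => ?_)
    · by_cases hx : x ∈ Z
      · simpa [ψ, hx] using continuous_const
      · simp only [ψ, Set.indicator_of_mem (show x ∈ Zᶜ from hx)]
        have hc : ContinuousOn (fun s => φ s x) (Set.Icc 0 1) := fun s hs =>
          ((hgood x hx).1 s hs).continuousAt.continuousWithinAt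
        exact hc.comp_continuous (continuous_subtype_val.comp continuous_projIcc)
          (fun s => (Set.projIcc 0 1 zero_le_one s).2)
    · exact (hφ _ (Set.projIcc 0 1 zero_le_one s).2).indicator hZm.compl
  let T : Set (ℝ × X) := Set.Ioo 0 1 ×ˢ Zᶜ
  have hT : MeasurableSet T := measurableSet_Ioo.prod hZm.compl
  -- No measurability of `φ'` is assumed; on `T` it is the limit of these jointly measurable
  -- difference quotients.
  let Δ : ℕ → ℝ × X → ℝ := fun n => T.indicator fun y =>
    ((n : ℝ) + 1) * (ψ (y.1 + ((n : ℝ) + 1)⁻¹) y.2 - ψ y.1 y.2)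
  have hΔm : ∀ n, Measurable (Δ n) := fun n => by
    refine Measurable.indicator (Measurable.const_mul (Measurable.sub ?_ hψm) _) hT
    exact hψm.comp ((measurable_fst.add_const _).prodMk measurable_snd)
  let D : ℝ × X → ℝ := T.indicator fun y => φ' y.1 y.2
  have hDm : Measurable D := by
    refine measurable_of_tendsto_metrizable hΔm (tendsto_pi_nhds.2 fun y => ?_)
    by_cases hy : y ∈ T
    · simp only [Δ, D, Set.indicator_of_mem hy]
      obtain ⟨⟨h0, h1⟩, hx⟩ := hy
      have hd := (hgood y.2 hx).1 y.1 ⟨h0.le, h1.le⟩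
      have hlim : Tendsto (fun n : ℕ => ((n : ℝ) + 1)⁻¹) atTop (𝓝[≠] 0) := by
        refine tendsto_nhdsWithin_iff.2 ⟨?_, Eventually.of_forall fun n => ?_⟩
        · simpa [one_div] using tendsto_one_div_add_atTop_nhds_zero_nat (𝕜 := ℝ)
        · simp only [Set.mem_compl_iff, Set.mem_singleton_iff]; positivity
      have h2 := (hasDerivAt_iff_tendsto_slope_zero.1 hd).comp hlim
      refine h2.congr' ?_
      have hev : ∀ᶠ n : ℕ in atTop, ((n : ℝ) + 1)⁻¹ < 1 - y.1 :=
        (tendsto_nhds_of_tendsto_nhdsWithin hlim).eventually (gt_mem_nhds (by linarith))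
      filter_upwards [hev] with n hn
      have hp : (0 : ℝ) < ((n : ℝ) + 1)⁻¹ := by positivity
      have e1 : ψ (y.1 + ((n : ℝ) + 1)⁻¹) y.2 = φ (y.1 + ((n : ℝ) + 1)⁻¹) y.2 := by
        simp only [ψ, Set.indicator_of_mem hx]
        rw [Set.projIcc_of_mem zero_le_one ⟨by linarith, by linarith⟩]
      have e2 : ψ y.1 y.2 = φ y.1 y.2 := by
        simp only [ψ, Set.indicator_of_mem hx]
        rw [Set.projIcc_of_mem zero_le_one ⟨h0.le, h1.le⟩]
      simp [e1, e2]
    · simp only [Δ, D, Set.indicator_of_notMem hy]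
      exact tendsto_const_nhds
  have hprob : IsProbabilityMeasure (volume.restrict (Set.Ioo (0 : ℝ) 1)) :=
    ⟨by simp⟩
  have hpt : ∀ᵐ x ∂ν, ‖φ 1 x - φ 0 x‖ₑ ^ 2 ≤ ∫⁻ s in Set.Ioo (0 : ℝ) 1, ‖D (s, x)‖ₑ ^ 2 := by
    have hZae : ∀ᵐ x ∂ν, x ∉ Z := measure_eq_zero_iff_ae_notMem.1 hZν
    filter_upwards [hZae] with x hx
    obtain ⟨hd, M, hM⟩ := hgood x hx
    have hDs : Measurable fun s => D (s, x) := hDm.comp measurable_prodMk_right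
    have hDeq : ∀ s ∈ Set.Ioo (0 : ℝ) 1, D (s, x) = φ' s x := fun s hs => by
      have : (s, x) ∈ T := ⟨hs, hx⟩
      simp [D, Set.indicator_of_mem this]
    -- The derivative need not be continuous in `s`; its boundedness along the path is what makes
    -- the fundamental theorem of calculus applicable.
    have hInt : IntegrableOn (fun s => φ' s x) (Set.Ioo 0 1) := by
      have : IntegrableOn (fun s => D (s, x)) (Set.Ioo 0 1) := by
        refine Integrable.of_bound (C := M) hDs.aestronglyMeasurable ?_
        filter_upwards [ae_restrict_mem measurableSet_Ioo] with s hs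
        rw [hDeq s hs]
        exact hM s ⟨hs.1.le, hs.2.le⟩
      exact this.congr_fun hDeq measurableSet_Ioo
    have hI : IntervalIntegrable (fun s => φ' s x) volume 0 1 := by
      rw [intervalIntegrable_iff_integrableOn_Ioo_of_le zero_le_one]
      exact hInt
    have hftc := intervalIntegral.integral_eq_sub_of_hasDerivAt (a := 0) (b := 1)
      (f := fun s => φ s x) (fun s hs => hd s (by simpa using hs)) hI
    have e : φ 1 x - φ 0 x = ∫ s in Set.Ioo (0 : ℝ) 1, D (s, x) := by
      rw [← hftc, intervalIntegral.integral_of_le zero_le_one, integral_Ioc_eq_integral_Ioo]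
      exact setIntegral_congr_fun measurableSet_Ioo fun s hs => (hDeq s hs).symm
    have h1 : ‖φ 1 x - φ 0 x‖ₑ ≤ eLpNorm (fun s => D (s, x)) 2
        (volume.restrict (Set.Ioo (0 : ℝ) 1)) := by
      rw [e]
      refine (enorm_integral_le_lintegral_enorm _).trans ?_
      rw [← eLpNorm_one_eq_lintegral_enorm]
      exact eLpNorm_le_eLpNorm_of_exponent_le (by norm_num) hDs.aestronglyMeasurable
    calc _ ≤ (eLpNorm (fun s => D (s, x)) 2 (volume.restrict (Set.Ioo (0 : ℝ) 1))) ^ 2 := by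
          gcongr
      _ = _ := by
          have := eLpNorm_nnreal_pow_eq_lintegral (p := 2) (f := fun s => D (s, x))
            (μ := volume.restrict (Set.Ioo (0 : ℝ) 1)) (by norm_num)
          simpa using this
  calc ∫⁻ x, ‖φ 1 x - φ 0 x‖ₑ ^ 2 ∂ν
      ≤ ∫⁻ x, (∫⁻ s in Set.Ioo (0 : ℝ) 1, ‖D (s, x)‖ₑ ^ 2) ∂ν := lintegral_mono_ae hpt
    _ = ∫⁻ s in Set.Ioo (0 : ℝ) 1, ∫⁻ x, ‖D (s, x)‖ₑ ^ 2 ∂ν := by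
        refine lintegral_lintegral_swap (f := fun x s => ‖D (s, x)‖ₑ ^ 2) ?_
        exact ((hDm.comp measurable_swap).enorm.pow_const 2).aemeasurable
    _ ≤ ∫⁻ s in Set.Ioo (0 : ℝ) 1, K := by
        refine setLIntegral_mono' measurableSet_Ioo fun s hs => ?_
        refine le_trans (lintegral_mono fun x => ?_) (hK s ⟨hs.1.le, hs.2.le⟩)
        by_cases hy : (s, x) ∈ T
        · simp [D, Set.indicator_of_mem hy]
        · simp [D, Set.indicator_of_notMem hy]
    _ = K := by simp

lemma measurable_intervalIntegral_of_continuous {f : ℝ → X → ℝ}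
    (hfc : ∀ x, Continuous fun t => f t x) (hfm : ∀ t, Measurable (f t)) (a b : ℝ) :
    Measurable fun x => ∫ r in a..b, f r x := by
  have h : StronglyMeasurable (Function.uncurry fun x r => f r x) :=
    ((measurable_uncurry_of_continuous_of_measurable hfc hfm).comp
      measurable_swap).stronglyMeasurable
  simp only [intervalIntegral]
  exact (h.integral_prod_right.measurable).sub h.integral_prod_right.measurable

lemma abs_intervalIntegral_le_of_abs_le {f : ℝ → ℝ} {M : ℝ} (hM : ∀ t, |f t| ≤ M) (τ : ℝ) :
    |∫ r in (0 : ℝ)..τ, f r| ≤ M * |τ| := by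
  simpa using intervalIntegral.norm_integral_le_of_norm_le_const (a := 0) (b := τ) (C := M)
    (f := f) (fun t _ => hM t)

/-- Differentiation under the integral sign of an exponential weight. -/
lemma hasDerivAt_integral_mul_exp_primitive {μ : Measure X} {f : ℝ → X → ℝ} {M : ℝ}
    (hfc : ∀ x, Continuous fun t => f t x) (hfm : ∀ t, Measurable (f t))
    (hM : ∀ᵐ x ∂μ, ∀ t, |f t x| ≤ M) {v : X → ℝ} (hv : Integrable v μ) (t : ℝ) :
    HasDerivAt (fun τ => ∫ x, v x * Real.exp (-∫ r in (0 : ℝ)..τ, f r x) ∂μ)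
      (∫ x, v x * (Real.exp (-∫ r in (0 : ℝ)..t, f r x) * -f t x) ∂μ) t := by
  have hwm : ∀ τ, Measurable fun x => Real.exp (-∫ r in (0 : ℝ)..τ, f r x) := fun τ =>
    (measurable_intervalIntegral_of_continuous hfc hfm 0 τ).neg.exp
  have hw : ∀ᵐ x ∂μ, ∀ τ ∈ Metric.ball t 1,
      Real.exp (-∫ r in (0 : ℝ)..τ, f r x) ≤ Real.exp (M * (|t| + 1)) := by
    filter_upwards [hM] with x hx τ hτ
    have hM0 : 0 ≤ M := (abs_nonneg _).trans (hx 0)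
    have h1 := abs_intervalIntegral_le_of_abs_le hx τ
    have h2 : |τ| ≤ |t| + 1 := by
      rw [Metric.mem_ball, Real.dist_eq] at hτ
      linarith [abs_sub_abs_le_abs_sub τ t]
    exact Real.exp_le_exp.2 ((neg_le_abs _).trans
      (h1.trans (mul_le_mul_of_nonneg_left h2 hM0)))
  refine (hasDerivAt_integral_of_dominated_loc_of_deriv_le
    (F := fun τ x => v x * Real.exp (-∫ r in (0 : ℝ)..τ, f r x))
    (F' := fun τ x => v x * (Real.exp (-∫ r in (0 : ℝ)..τ, f r x) * -f τ x))
    (bound := fun x => |v x| * (Real.exp (M * (|t| + 1)) * M))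
    (Metric.ball_mem_nhds t one_pos) ?_ ?_ ?_ ?_ ?_ ?_).2
  · exact Eventually.of_forall fun τ => hv.1.mul (hwm τ).aestronglyMeasurable
  · refine hv.mul_bdd (c := Real.exp (M * (|t| + 1))) (hwm t).aestronglyMeasurable ?_
    filter_upwards [hw] with x hx
    rw [Real.norm_eq_abs, abs_of_pos (Real.exp_pos _)]
    exact hx t (Metric.mem_ball_self one_pos)
  · exact hv.1.mul ((hwm t).mul (hfm t).neg).aestronglyMeasurable
  · filter_upwards [hw, hM] with x hx hMx τ hτ
    rw [norm_mul, norm_mul, norm_neg, Real.norm_eq_abs, Real.norm_eq_abs, Real.norm_eq_abs,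
      abs_of_pos (Real.exp_pos _)]
    gcongr
    exacts [Real.exp_le_exp.1 (hx τ hτ), hMx τ]
  · exact hv.abs.mul_const _
  · refine Eventually.of_forall fun x τ _ => ?_
    have h := ((hfc x).integral_hasStrictDerivAt 0 τ).hasDerivAt
    exact (h.neg.exp).const_mul (v x)

/-- If `t ↦ s t` is differentiable in `L¹` with derivative `f t * s t`, where `f` is bounded, then
`∫ s t exp (-∫₀ᵗ f)` does not depend on `t`. -/
lemma integral_mul_exp_primitive_eq {μ : Measure X} {f s : ℝ → X → ℝ} {M : ℝ}
    (hfc : ∀ x, Continuous fun t => f t x) (hfm : ∀ t, Measurable (f t))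
    (hM : ∀ᵐ x ∂μ, ∀ t, |f t x| ≤ M)
    (hs : ∀ t ∈ Set.Icc (0 : ℝ) 1, Integrable (s t) μ)
    (hsd : ∀ t ∈ Set.Icc (0 : ℝ) 1,
      (fun τ => ∫ x, |s τ x - s t x - (τ - t) * (f t x * s t x)| ∂μ)
        =o[𝓝[Set.Icc 0 1] t] fun τ => τ - t) :
    ∫ x, s 1 x * Real.exp (-∫ r in (0 : ℝ)..1, f r x) ∂μ = ∫ x, s 0 x ∂μ := by
  let w : ℝ → X → ℝ := fun τ x => Real.exp (-∫ r in (0 : ℝ)..τ, f r x)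
  have hwm : ∀ τ, Measurable (w τ) := fun τ =>
    (measurable_intervalIntegral_of_continuous hfc hfm 0 τ).neg.exp
  have hw : ∀ τ ∈ Set.Icc (0 : ℝ) 1, ∀ᵐ x ∂μ, ‖w τ x‖ ≤ Real.exp M := by
    intro τ hτ
    filter_upwards [hM] with x hx
    rw [Real.norm_eq_abs, abs_of_pos (Real.exp_pos _)]
    have hM0 : 0 ≤ M := (abs_nonneg _).trans (hx 0)
    refine Real.exp_le_exp.2 ((neg_le_abs _).trans
      ((abs_intervalIntegral_le_of_abs_le hx τ).trans ?_))
    rw [abs_of_nonneg hτ.1]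
    nlinarith [hτ.2]
  let Φ : ℝ → ℝ := fun τ => ∫ x, s τ x * w τ x ∂μ
  have hderiv : ∀ t ∈ Set.Icc (0 : ℝ) 1, HasDerivWithinAt Φ 0 (Set.Icc 0 1) t := by
    intro t ht
    have hfs : Integrable (fun x => f t x * s t x) μ :=
      (hs t ht).bdd_mul (c := M) (hfm t).aestronglyMeasurable (hM.mono fun x hx => hx t)
    -- A product rule by hand, as `s` is differentiable only in `L¹`. Replacing `s τ` by its
    -- first-order expansion at `t` leaves the moving weight `w` against fixed functions, plus `ρ`,
    -- which is `o(τ - t)` because `w` is bounded. The two contributions `∓ ∫ f s w` cancel.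
    let ρ : ℝ → ℝ := fun τ => ∫ x, (s τ x - s t x - (τ - t) * (f t x * s t x)) * w τ x ∂μ
    have hρ : HasDerivWithinAt ρ 0 (Set.Icc 0 1) t := by
      have hρt : ρ t = 0 := by simp [ρ]
      rw [hasDerivWithinAt_iff_isLittleO]
      simp only [hρt, smul_zero, sub_zero]
      refine IsBigO.trans_isLittleO ?_ (hsd t ht)
      refine IsBigO.of_bound (Real.exp M) ?_
      filter_upwards [self_mem_nhdsWithin] with τ hτ
      have hint : Integrable (fun x => s τ x - s t x - (τ - t) * (f t x * s t x)) μ :=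
        ((hs τ hτ).sub (hs t ht)).sub (hfs.const_mul _)
      calc ‖ρ τ‖ ≤ ∫ x, Real.exp M * |s τ x - s t x - (τ - t) * (f t x * s t x)| ∂μ := by
            refine norm_integral_le_of_norm_le (hint.abs.const_mul _) ?_
            filter_upwards [hw τ hτ] with x hx
            rw [norm_mul, mul_comm, Real.norm_eq_abs (s τ x - _ - _)]
            gcongr
        _ = Real.exp M * ∫ x, |s τ x - s t x - (τ - t) * (f t x * s t x)| ∂μ :=
            integral_const_mul _ _
        _ ≤ _ := by gcongr; exact le_abs_self _
    have hΨ := (hasDerivAt_integral_mul_exp_primitive hfc hfm hM (hs t ht) t).hasDerivWithinAt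
      (s := Set.Icc 0 1)
    have hκ := (hasDerivAt_integral_mul_exp_primitive hfc hfm hM hfs t).hasDerivWithinAt
      (s := Set.Icc 0 1)
    have hlin : HasDerivWithinAt (fun τ : ℝ => τ - t) 1 (Set.Icc 0 1) t :=
      ((hasDerivAt_id t).sub_const t).hasDerivWithinAt
    have htot := (hΨ.add (hlin.mul hκ)).add hρ
    have heq : ∀ τ ∈ Set.Icc (0 : ℝ) 1, Φ τ = (∫ x, s t x * w τ x ∂μ)
        + (τ - t) * (∫ x, f t x * s t x * w τ x ∂μ) + ρ τ := by
      intro τ hτ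
      have i1 : Integrable (fun x => s t x * w τ x) μ :=
        (hs t ht).mul_bdd (hwm τ).aestronglyMeasurable (hw τ hτ)
      have i2 : Integrable (fun x => (τ - t) * (f t x * s t x * w τ x)) μ :=
        (hfs.mul_bdd (hwm τ).aestronglyMeasurable (hw τ hτ)).const_mul _
      have i3 : Integrable
          (fun x => (s τ x - s t x - (τ - t) * (f t x * s t x)) * w τ x) μ :=
        (((hs τ hτ).sub (hs t ht)).sub (hfs.const_mul _)).mul_bdd
          (hwm τ).aestronglyMeasurable (hw τ hτ)
      have i12 : Integrable
          (fun x => s t x * w τ x + (τ - t) * (f t x * s t x * w τ x)) μ := i1.add i2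
      simp only [Φ, ρ]
      rw [← integral_const_mul, ← integral_add i1 i2, ← integral_add i12 i3]
      congr 1; ext x; ring
    refine (htot.congr heq (heq t ht)).congr_deriv ?_
    simp only [sub_self, zero_mul, one_mul, add_zero]
    rw [← integral_add]
    · rw [← integral_zero X ℝ (μ := μ)]
      congr 1; ext x; ring
    · have := ((hfs.mul_bdd (hwm t).aestronglyMeasurable (hw t ht)).const_mul (-1))
      refine this.congr (Eventually.of_forall fun x => ?_)
      simp only [w]; ring
    · exact hfs.mul_bdd (hwm t).aestronglyMeasurable (hw t ht)
  have hconst := constant_of_derivWithin_zero (f := Φ) (a := 0) (b := 1)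
    (fun t ht => (hderiv t ht).differentiableWithinAt)
    (fun t ht => (hderiv t ⟨ht.1, ht.2.le⟩).derivWithin
      (uniqueDiffOn_Icc zero_lt_one t ⟨ht.1, ht.2.le⟩)) 1 (by simp)
  simpa [Φ, w] using hconst

lemma isLittleO_integral_abs_mono_measure {μ ν : Measure X} (hνμ : ν ≤ μ) {R : ℝ → X → ℝ}
    {l : Filter ℝ} {k : ℝ → ℝ} (hR : ∀ᶠ τ in l, Integrable (R τ) μ)
    (h : (fun τ => ∫ x, |R τ x| ∂μ) =o[l] k) : (fun τ => ∫ x, |R τ x| ∂ν) =o[l] k := by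
  refine IsBigO.trans_isLittleO (IsBigO.of_bound 1 ?_) h
  filter_upwards [hR] with τ hτ
  rw [one_mul, Real.norm_of_nonneg (integral_nonneg fun _ => abs_nonneg _),
    Real.norm_of_nonneg (integral_nonneg fun _ => abs_nonneg _)]
  exact integral_mono_measure hνμ (Eventually.of_forall fun _ => abs_nonneg _) hτ.abs

/-- Uniqueness for the linear equation `s' = f s` in `L¹`, with a coefficient `f` that is
continuous in time. -/
lemma ae_eq_mul_exp_of_L1_hasDeriv {μ : Measure X} {f s : ℝ → X → ℝ}
    (hfc : ∀ x, Continuous fun t => f t x) (hfm : ∀ t, Measurable (f t))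
    (hfb : ∀ x, ∃ M : ℝ, ∀ t, |f t x| ≤ M)
    (hs : ∀ t ∈ Set.Icc (0 : ℝ) 1, Integrable (s t) μ)
    (hfs : ∀ t ∈ Set.Icc (0 : ℝ) 1, Integrable (fun x => f t x * s t x) μ)
    (hsd : ∀ t ∈ Set.Icc (0 : ℝ) 1,
      (fun τ => ∫ x, |s τ x - s t x - (τ - t) * (f t x * s t x)| ∂μ)
        =o[𝓝[Set.Icc 0 1] t] fun τ => τ - t) :
    ∀ᵐ x ∂μ, s 1 x = s 0 x * Real.exp (∫ r in (0 : ℝ)..1, f r x) := by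
  -- The bound on `f` varies with `x`, so the space is cut into countably many pieces with a uniform
  -- bound. Rational times keep the pieces measurable, and continuity recovers all times.
  let E : ℕ → Set X := fun m => {x | ∀ q : ℚ, |f q x| ≤ m}
  have hE : ∀ m, MeasurableSet (E m) := fun m => by
    have : E m = ⋂ q : ℚ, {x | |f q x| ≤ m} := by ext x; simp [E]
    rw [this]
    exact MeasurableSet.iInter fun q => measurableSet_le (hfm q).abs measurable_const
  have hEb : ∀ m, ∀ x ∈ E m, ∀ t, |f t x| ≤ m := fun m x hx t => by
    have hcl : IsClosed {t : ℝ | |f t x| ≤ m} := isClosed_le (hfc x).abs continuous_const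
    exact Rat.denseRange_cast.induction_on (p := fun t : ℝ => |f t x| ≤ m) t hcl hx
  have hEu : (⋃ m, E m) = Set.univ := by
    refine Set.eq_univ_of_forall fun x => ?_
    obtain ⟨M, hM⟩ := hfb x
    obtain ⟨m, hm⟩ := exists_nat_ge M
    exact Set.mem_iUnion.2 ⟨m, fun q => (hM q).trans hm⟩
  have hwm : Measurable fun x => Real.exp (-∫ r in (0 : ℝ)..1, f r x) :=
    (measurable_intervalIntegral_of_continuous hfc hfm 0 1).neg.exp
  rw [← Measure.restrict_univ (μ := μ), ← hEu, ae_restrict_iUnion_iff]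
  intro m
  set ν := μ.restrict (E m)
  have hνb : ∀ᵐ x ∂ν, ∀ t, |f t x| ≤ m := by
    filter_upwards [ae_restrict_mem (hE m)] with x hx using hEb m x hx
  have h1 : Integrable (fun x => s 1 x * Real.exp (-∫ r in (0 : ℝ)..1, f r x)) ν := by
    refine (hs 1 (by simp)).restrict.mul_bdd (c := Real.exp m) hwm.aestronglyMeasurable ?_
    filter_upwards [hνb] with x hx
    rw [Real.norm_eq_abs, abs_of_pos (Real.exp_pos _)]
    refine Real.exp_le_exp.2 ((neg_le_abs _).trans
      ((abs_intervalIntegral_le_of_abs_le hx 1).trans (by simp)))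
  have h0 : Integrable (s 0) ν := (hs 0 (by simp)).restrict
  -- The conserved integral, applied on every measurable subset `A`, turns an equality of integrals
  -- into an almost everywhere equality.
  have hz := Integrable.ae_eq_zero_of_forall_setIntegral_eq_zero (h1.sub h0) (by
    intro A hA _
    have hle : ν.restrict A ≤ μ := Measure.restrict_le_self.trans Measure.restrict_le_self
    have := integral_mul_exp_primitive_eq (μ := ν.restrict A) (M := m) hfc hfm
      (ae_restrict_of_ae hνb) (fun t ht => (hs t ht).mono_measure hle)
      (fun t ht => isLittleO_integral_abs_mono_measure hle (by
        filter_upwards [self_mem_nhdsWithin] with τ hτ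
        exact ((hs τ hτ).sub (hs t ht)).sub ((hfs t ht).const_mul _)) (hsd t ht))
    simp only [Pi.sub_apply]
    rw [integral_sub h1.restrict h0.restrict, this, sub_self])
  filter_upwards [hz] with x hx
  simp only [Pi.sub_apply, Pi.zero_apply, sub_eq_zero, Real.exp_neg] at hx
  rw [← hx, inv_mul_cancel_right₀ (Real.exp_pos _).ne']

end Paths

end Prediction

/-! ### Root densities -/

namespace Prediction

noncomputable section

variable {X : Type*} [MeasurableSpace X]

/-- The square root of the density of `ρ` with respect to `μ`. -/
def rootDensity (ρ μ : Measure X) (x : X) : ℝ := √(ρ.rnDeriv μ x).toReal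

lemma measurable_rootDensity (ρ μ : Measure X) : Measurable (rootDensity ρ μ) :=
  (Measure.measurable_rnDeriv ρ μ).ennreal_toReal.sqrt

lemma rootDensity_sq (ρ μ : Measure X) (x : X) :
    rootDensity ρ μ x ^ 2 = (ρ.rnDeriv μ x).toReal :=
  Real.sq_sqrt ENNReal.toReal_nonneg

lemma enorm_rootDensity_sq (ρ μ : Measure X) [SigmaFinite ρ] :
    ∀ᵐ x ∂μ, ‖rootDensity ρ μ x‖ₑ ^ 2 = ρ.rnDeriv μ x := by
  filter_upwards [Measure.rnDeriv_lt_top ρ μ] with x hx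
  rw [← enorm_pow, rootDensity_sq, Real.enorm_eq_ofReal ENNReal.toReal_nonneg,
    ENNReal.ofReal_toReal hx.ne]

lemma eLpNorm_two_eq {μ : Measure X} (f : X → ℝ) :
    eLpNorm f 2 μ = (∫⁻ x, ‖f x‖ₑ ^ 2 ∂μ) ^ (1 / 2 : ℝ) := by
  rw [eLpNorm_eq_lintegral_rpow_enorm_toReal (by norm_num) (by norm_num)]
  simp

lemma eLpNorm_two_eq_ofReal_sqrt {μ : Measure X} {f : X → ℝ} (hf : MemLp f 2 μ) :
    eLpNorm f 2 μ = ENNReal.ofReal (√(∫ x, f x ^ 2 ∂μ)) := by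
  rw [hf.eLpNorm_eq_integral_rpow_norm (by norm_num) (by norm_num), Real.sqrt_eq_rpow]
  simp

/-- Multiplication by the root density is an isometry from `L²(ρ)` into `L²(μ)`; it carries
estimates under a moving measure to a fixed one. -/
lemma eLpNorm_mul_rootDensity {ρ μ : Measure X} [SigmaFinite ρ] [SigmaFinite μ] (h : ρ ≪ μ)
    {f : X → ℝ} (hf : AEStronglyMeasurable f μ) :
    eLpNorm (fun x => f x * rootDensity ρ μ x) 2 μ = eLpNorm f 2 ρ := by
  rw [eLpNorm_two_eq, eLpNorm_two_eq, ← lintegral_rnDeriv_mul h (hf.enorm.pow_const 2)]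
  congr 1
  refine lintegral_congr_ae ?_
  filter_upwards [enorm_rootDensity_sq ρ μ] with x hx
  rw [enorm_mul, mul_pow, hx, mul_comm]

lemma memLp_rootDensity {ρ μ : Measure X} [IsFiniteMeasure ρ] [SigmaFinite μ] (h : ρ ≪ μ) :
    MemLp (rootDensity ρ μ) 2 μ := by
  refine ⟨(measurable_rootDensity ρ μ).aestronglyMeasurable, ?_⟩
  have := eLpNorm_mul_rootDensity h (f := fun _ => 1) aestronglyMeasurable_const
  simp only [one_mul] at this
  rw [show rootDensity ρ μ = fun x => rootDensity ρ μ x from rfl, this]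
  exact (memLp_const (1 : ℝ)).2

lemma integral_mul_rootDensity_sq {ρ μ : Measure X} [SigmaFinite ρ] [SigmaFinite μ] (h : ρ ≪ μ)
    (f : X → ℝ) : ∫ x, f x * rootDensity ρ μ x ^ 2 ∂μ = ∫ x, f x ∂ρ := by
  rw [← integral_rnDeriv_smul h]
  congr 1; ext x
  rw [rootDensity_sq, smul_eq_mul, mul_comm]

lemma rootDensity_mul {ρ σ μ : Measure X} [SigmaFinite ρ] [SigmaFinite σ] [SigmaFinite μ]
    (h : ρ ≪ σ) :
    ∀ᵐ x ∂μ, rootDensity ρ μ x = rootDensity ρ σ x * rootDensity σ μ x := by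
  filter_upwards [Measure.rnDeriv_mul_rnDeriv (κ := μ) h] with x hx
  rw [rootDensity, ← hx, Pi.mul_apply, ENNReal.toReal_mul, Real.sqrt_mul ENNReal.toReal_nonneg]
  rfl

variable {d : ℕ} {P : Euc d → Measure X} {Θ : Set (Euc d)} {θ : Euc d} {l : X → Euc d}

/-- The remainder in the `L²`-expansion of the root density. -/
def rootRemainder (P : Euc d → Measure X) (θ : Euc d) (l : X → Euc d) (u : Euc d) (x : X) : ℝ :=
  rootDensity (P (θ + u)) (P θ) x - 1 - 1 / 2 * ⟪u, l x⟫

lemma memLp_rootRemainder [IsProbabilityMeasure (P θ)] (hl : MemLp l 2 (P θ)) {u : Euc d}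
    [IsProbabilityMeasure (P (θ + u))] (h : P (θ + u) ≪ P θ) :
    MemLp (rootRemainder P θ l u) 2 (P θ) :=
  ((memLp_rootDensity h).sub (memLp_const 1)).sub ((hl.const_inner u).const_mul _)

lemma HasL2DerivAt.isLittleO_sqrt (h : HasL2DerivAt P Θ θ l) :
    (fun u => √(∫ x, rootRemainder P θ l u x ^ 2 ∂(P θ))) =o[𝓝 0] fun u => u := by
  rw [isLittleO_iff]
  intro c hc
  filter_upwards [(isLittleO_iff.1 h.isLittleO) (show 0 < c ^ 2 by positivity)] with u hu
  rw [Real.norm_of_nonneg (Real.sqrt_nonneg _)]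
  refine Real.sqrt_le_iff.2 ⟨by positivity, ?_⟩
  refine (le_abs_self _).trans (hu.trans_eq ?_)
  rw [norm_pow, norm_norm, mul_pow]

lemma HasL2DerivAt.eventually_absolutelyContinuous (h : HasL2DerivAt P Θ θ l) :
    ∀ᶠ η in 𝓝 θ, η ∈ Θ ∧ P η ≪ P θ := by
  obtain ⟨U, hU, hUΘ, hUa⟩ := h.absolutelyContinuous
  filter_upwards [hU] with η hη using ⟨hUΘ hη, hUa η hη⟩

end

end Prediction

/-! ### Equality in the Cramér–Rao inequality -/

namespace Prediction

section CramerRao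

variable {X : Type*} [MeasurableSpace X] {d : ℕ} {P : Euc d → Measure X} {Θ : Set (Euc d)}
  {ℓ : Euc d → X → Euc d} {g : X → Euc d → Euc d} {p : X → Euc d}

lemma memLp_coord {ν : Measure X} {f : X → Euc d} {q : ℝ≥0∞} (hf : MemLp f q ν) (i : Fin d) :
    MemLp (fun x => f x i) q ν :=
  (EuclideanSpace.proj (𝕜 := ℝ) i : Euc d →L[ℝ] ℝ).comp_memLp' hf

lemma integral_coord {ν : Measure X} {f : X → Euc d} (hf : Integrable f ν) (i : Fin d) :
    ∫ x, f x i ∂ν = (∫ x, f x ∂ν) i :=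
  (EuclideanSpace.proj (𝕜 := ℝ) i : Euc d →L[ℝ] ℝ).integral_comp_comm hf

lemma measurable_coord {f : X → Euc d} (hf : Measurable f) (i : Fin d) :
    Measurable fun x => f x i :=
  (EuclideanSpace.proj (𝕜 := ℝ) i : Euc d →L[ℝ] ℝ).measurable.comp hf

/-- The increments of `g(X, ·)` are Lipschitz in `L²`. -/
lemma lintegral_increment_sq_le {ν : Measure X} [SFinite ν]
    (hg : ∀ θ ∈ Θ, Measurable fun x => g x θ)
    (hbdd : ∀ x, ∀ C' : Set (Euc d), IsCompact C' → C' ⊆ Θ →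
      ∃ M : ℝ, ∀ θ ∈ C', DifferentiableAt ℝ (g x) θ → ‖fderiv ℝ (g x) θ‖ ≤ M)
    {θ₁ u : Euc d} (hΘ : ∀ s ∈ Set.Icc (0 : ℝ) 1, θ₁ + s • u ∈ Θ)
    (hd : ∀ᵐ x ∂ν, ∀ s ∈ Set.Icc (0 : ℝ) 1, DifferentiableAt ℝ (g x) (θ₁ + s • u)) {K : ℝ≥0∞}
    (hK : ∀ s ∈ Set.Icc (0 : ℝ) 1, ∫⁻ x, ‖fderiv ℝ (g x) (θ₁ + s • u)‖ₑ ^ 2 ∂ν ≤ K)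
    (i : Fin d) :
    ∫⁻ x, ‖(g x (θ₁ + u) - g x θ₁) i‖ₑ ^ 2 ∂ν ≤ K * ‖u‖ₑ ^ 2 := by
  have hn : ∀ (x : X) (s : ℝ), |(fderiv ℝ (g x) (θ₁ + s • u) u) i| ≤
      ‖fderiv ℝ (g x) (θ₁ + s • u)‖ * ‖u‖ := fun x s => by
    rw [← Real.norm_eq_abs]
    exact (PiLp.norm_apply_le _ i).trans (ContinuousLinearMap.le_opNorm _ _)
  have h := lintegral_sub_sq_le_of_hasDerivAt (ν := ν) (K := K * ‖u‖ₑ ^ 2)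
    (φ := fun s x => g x (θ₁ + s • u) i)
    (φ' := fun s x => (fderiv ℝ (g x) (θ₁ + s • u) u) i)
    (fun s hs => measurable_coord (hg _ (hΘ s hs)) i) ?_ ?_ ?_
  · simpa using h
  · filter_upwards [hd] with x hx s hs
    have h1 : HasDerivAt (fun s : ℝ => θ₁ + s • u) u s := by
      simpa using ((hasDerivAt_id s).smul_const u).const_add θ₁
    have h2 := (hx s hs).hasFDerivAt.comp_hasDerivAt s h1
    exact (EuclideanSpace.proj (𝕜 := ℝ) i : Euc d →L[ℝ] ℝ).hasFDerivAt.comp_hasDerivAt s h2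
  · filter_upwards [hd] with x hx
    -- The pointwise bound on the Jacobian over this compact segment may depend on `x`; the final
    -- estimate involves only `K`.
    have hcomp : IsCompact ((fun s : ℝ => θ₁ + s • u) '' Set.Icc 0 1) :=
      isCompact_Icc.image (by fun_prop)
    obtain ⟨M, hM⟩ := hbdd x _ hcomp (by rintro _ ⟨s, hs, rfl⟩; exact hΘ s hs)
    refine ⟨M * ‖u‖, fun s hs => (hn x s).trans ?_⟩
    exact mul_le_mul_of_nonneg_right (hM _ ⟨s, hs, rfl⟩ (hx s hs)) (norm_nonneg _)
  · intro s hs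
    calc ∫⁻ x, ‖(fderiv ℝ (g x) (θ₁ + s • u) u) i‖ₑ ^ 2 ∂ν
        ≤ ∫⁻ x, ‖fderiv ℝ (g x) (θ₁ + s • u)‖ₑ ^ 2 * ‖u‖ₑ ^ 2 ∂ν := by
          refine lintegral_mono fun x => ?_
          rw [← mul_pow]
          gcongr
          rw [← ofReal_norm, ← ofReal_norm, ← ofReal_norm,
            ← ENNReal.ofReal_mul (norm_nonneg _)]
          exact ENNReal.ofReal_le_ofReal (hn x s)
      _ = (∫⁻ x, ‖fderiv ℝ (g x) (θ₁ + s • u)‖ₑ ^ 2 ∂ν) * ‖u‖ₑ ^ 2 :=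
          lintegral_mul_const' _ _ (by finiteness)
      _ ≤ K * ‖u‖ₑ ^ 2 := by gcongr; exact hK s hs

lemma continuousOn_matrix_inv {n : ℕ} {s : Set (Euc d)} {M : Euc d → Matrix (Fin n) (Fin n) ℝ}
    (hM : ContinuousOn M s) (hu : ∀ θ ∈ s, IsUnit (M θ)) : ContinuousOn (fun θ => (M θ)⁻¹) s := by
  simp only [Matrix.inv_def, Ring.inverse_eq_inv']
  intro θ hθ
  have hdet : (M θ).det ≠ 0 := ((Matrix.isUnit_iff_isUnit_det _).1 (hu θ hθ)).ne_zero
  have h1 : ContinuousWithinAt (fun θ => (M θ).det) s θ :=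
    (continuous_id.matrix_det.continuousAt).comp_continuousWithinAt (hM θ hθ)
  have h2 : ContinuousWithinAt (fun θ => (M θ).adjugate) s θ :=
    (continuous_id.matrix_adjugate.continuousAt).comp_continuousWithinAt (hM θ hθ)
  exact (h1.inv₀ hdet).smul h2

/-- The covariance of the prediction error and the score is the mean Jacobian. -/
lemma integral_error_mul_score_eq_meanJacobian (hΘ_open : IsOpen Θ)
    (hP : ∀ θ ∈ Θ, IsProbabilityMeasure (P θ))
    (hg : ∀ θ ∈ Θ, Measurable fun x => g x θ) (hp : Measurable p)
    (hreg : ∀ θ ∈ Θ, RegularAt P Θ ℓ g p θ) (hunb : IsUnbiased P Θ g p)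
    (heff : IsEfficient P Θ ℓ g p)
    (hbdd : ∀ x, ∀ C' : Set (Euc d), IsCompact C' → C' ⊆ Θ →
      ∃ M : ℝ, ∀ θ ∈ C', DifferentiableAt ℝ (g x) θ → ‖fderiv ℝ (g x) θ‖ ≤ M)
    (hI_cont : ContinuousOn (fisherInfo P ℓ) Θ)
    (hG_cont : ContinuousOn (meanJacobian P g) Θ) {θ₁ : Euc d} (hθ₁ : θ₁ ∈ Θ) (i j : Fin d) :
    ∫ x, (p x - g x θ₁) i * ℓ θ₁ x j ∂(P θ₁) = meanJacobian P g θ₁ i j := by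
  have hprob₁ := hP θ₁ hθ₁
  have hL2 := (hreg θ₁ hθ₁).hasL2DerivAt
  obtain ⟨U, hU, hUΘ, hUd, hUK, -⟩ := (hreg θ₁ hθ₁).exists_nhds
  set K : ℝ≥0∞ := ⨆ θ ∈ U, ⨆ θ' ∈ U, ∫⁻ x, ‖fderiv ℝ (g x) θ'‖ₑ ^ 2 ∂(P θ) with hK
  have hKle : ∀ θ ∈ U, ∀ θ' ∈ U, ∫⁻ x, ‖fderiv ℝ (g x) θ'‖ₑ ^ 2 ∂(P θ) ≤ K := fun θ hθ θ' hθ' =>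
    (le_iSup₂ (f := fun θ' (_ : θ' ∈ U) => ∫⁻ x, ‖fderiv ℝ (g x) θ'‖ₑ ^ 2 ∂(P θ)) θ' hθ').trans
      (le_iSup₂ (f := fun θ (_ : θ ∈ U) =>
        ⨆ θ' ∈ U, ∫⁻ x, ‖fderiv ℝ (g x) θ'‖ₑ ^ 2 ∂(P θ)) θ hθ)
  obtain ⟨r, hr, hball⟩ := Metric.eventually_nhds_iff_ball.1
    (hL2.eventually_absolutelyContinuous.and hU)
  set e : Euc d := EuclideanSpace.single j 1 with he
  have hen : ‖e‖ = 1 := by simp [he]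
  let τ : ℕ → ℝ := fun n => r / 2 * (1 / ((n : ℝ) + 1))
  have hτ0 : ∀ n, 0 < τ n := fun n => by positivity
  have hτr : ∀ n, τ n < r := fun n => by
    have : 1 / ((n : ℝ) + 1) ≤ 1 := by
      rw [div_le_one (by positivity)]; linarith [(Nat.cast_nonneg n : (0 : ℝ) ≤ n)]
    simp only [τ]; nlinarith
  have hτlim : Tendsto τ atTop (𝓝 0) := by
    simpa [τ] using (tendsto_one_div_add_atTop_nhds_zero_nat (𝕜 := ℝ)).const_mul (r / 2)
  have hseg : ∀ n, ∀ s ∈ Set.Icc (0 : ℝ) 1, θ₁ + s • (τ n • e) ∈ Metric.ball θ₁ r := by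
    intro n s hs
    rw [Metric.mem_ball, dist_self_add_left, norm_smul, norm_smul, hen, mul_one,
      Real.norm_of_nonneg hs.1, Real.norm_of_nonneg (hτ0 n).le]
    nlinarith [hτ0 n, hτr n, hs.1, hs.2]
  have hend : ∀ n, θ₁ + τ n • e ∈ Metric.ball θ₁ r := fun n => by
    simpa using hseg n 1 (by simp)
  have hself : θ₁ ∈ Metric.ball θ₁ r := Metric.mem_ball_self hr
  have hprob : ∀ n, IsProbabilityMeasure (P (θ₁ + τ n • e)) := fun n =>
    hP _ (hball _ (hend n)).1.1
  have hac : ∀ n, P (θ₁ + τ n • e) ≪ P θ₁ := fun n => (hball _ (hend n)).1.2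
  let S : ℕ → X → ℝ := fun n => rootDensity (P (θ₁ + τ n • e)) (P θ₁)
  have hSL : ∀ n, MemLp (S n) 2 (P θ₁) := fun n => memLp_rootDensity (hac n)
  have hl : MemLp (fun x => ℓ θ₁ x j) 2 (P θ₁) := memLp_coord hL2.memLp j
  -- expansion of the root densities along the sequence
  have hexp : Tendsto (fun n => eLpNorm (fun x => (S n x - 1) / τ n - 1 / 2 * ℓ θ₁ x j) 2 (P θ₁))
      atTop (𝓝 0) := by
    have hu : Tendsto (fun n => τ n • e) atTop (𝓝 0) := by
      simpa using hτlim.smul_const e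
    have h1 : (fun n => √(∫ x, rootRemainder P θ₁ (ℓ θ₁) (τ n • e) x ^ 2 ∂(P θ₁)))
        =o[atTop] τ := by
      refine (hL2.isLittleO_sqrt.comp_tendsto hu).trans_isBigO (IsBigO.of_bound 1 ?_)
      refine Eventually.of_forall fun n => ?_
      simp [norm_smul, hen]
    have h2 := ENNReal.tendsto_ofReal h1.tendsto_div_nhds_zero
    rw [ENNReal.ofReal_zero] at h2
    refine h2.congr fun n => ?_
    have e1 : (fun x => (S n x - 1) / τ n - 1 / 2 * ℓ θ₁ x j) =
        (τ n)⁻¹ • rootRemainder P θ₁ (ℓ θ₁) (τ n • e) := by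
      ext x
      have : ⟪τ n • e, ℓ θ₁ x⟫ = τ n * ℓ θ₁ x j := by
        rw [real_inner_smul_left, he, EuclideanSpace.inner_single_left]; simp
      simp only [Pi.smul_apply, rootRemainder, this, smul_eq_mul, S]
      have := (hτ0 n).ne'
      field_simp
    rw [e1, eLpNorm_const_smul,
      eLpNorm_two_eq_ofReal_sqrt (memLp_rootRemainder hL2.memLp (hac n)),
      Real.enorm_eq_ofReal (inv_nonneg.2 (hτ0 n).le),
      ← ENNReal.ofReal_mul (inv_nonneg.2 (hτ0 n).le), div_eq_inv_mul]
  have hS1 : Tendsto (fun n => eLpNorm (fun x => S n x - 1) 2 (P θ₁)) atTop (𝓝 0) := by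
    have h1 : Tendsto (fun n => ENNReal.ofReal (τ n) *
        (eLpNorm (fun x => (S n x - 1) / τ n - 1 / 2 * ℓ θ₁ x j) 2 (P θ₁)
          + eLpNorm (fun x => 1 / 2 * ℓ θ₁ x j) 2 (P θ₁))) atTop
        (𝓝 (0 * (0 + eLpNorm (fun x => 1 / 2 * ℓ θ₁ x j) 2 (P θ₁)))) := by
      refine ENNReal.Tendsto.mul ?_ (Or.inr ?_) (hexp.add_const _) (Or.inr (by simp))
      · simpa using ENNReal.tendsto_ofReal hτlim
      · simpa using (hl.const_mul (1 / 2)).2.ne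
    rw [zero_mul] at h1
    refine tendsto_of_tendsto_of_tendsto_of_le_of_le tendsto_const_nhds h1
      (fun _ => zero_le) fun n => ?_
    have e1 : (fun x => S n x - 1) = τ n • ((fun x => (S n x - 1) / τ n - 1 / 2 * ℓ θ₁ x j)
        + fun x => 1 / 2 * ℓ θ₁ x j) := by
      ext x
      have := (hτ0 n).ne'
      simp only [Pi.smul_apply, Pi.add_apply, smul_eq_mul]
      field_simp
      ring
    have hm : AEStronglyMeasurable (fun x => (S n x - 1) / τ n - 1 / 2 * ℓ θ₁ x j) (P θ₁) := by
      refine AEStronglyMeasurable.sub ?_ (hl.const_mul _).1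
      simp only [div_eq_mul_inv]
      exact ((hSL n).1.sub aestronglyMeasurable_const).mul_const _
    simp only
    rw [e1, eLpNorm_const_smul, Real.enorm_eq_ofReal (hτ0 n).le]
    gcongr
    exact eLpNorm_add_le hm (hl.const_mul _).1 (by norm_num)
  -- Convergence in `L²` gives almost everywhere convergence only along a subsequence, which is
  -- enough to identify a limit.
  obtain ⟨ns, hns, hSae⟩ := (tendstoInMeasure_of_tendsto_eLpNorm (μ := P θ₁) (p := 2)
    (f := S) (g := fun _ => 1) (by norm_num) (fun n => (hSL n).1) aestronglyMeasurable_const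
    hS1).exists_seq_tendsto_ae
  -- the difference quotients of `g`
  let q : ℕ → X → ℝ := fun n x => (g x (θ₁ + τ n • e) - g x θ₁) i / τ n
  have hqm : ∀ n, Measurable (q n) := fun n =>
    (measurable_coord ((hg _ (hball _ (hend n)).1.1).sub (hg _ hθ₁)) i).div_const _
  have hqK : ∀ n, ∀ θ ∈ Metric.ball θ₁ r, eLpNorm (q n) 2 (P θ) ≤ K ^ (1 / 2 : ℝ) := by
    intro n θ hθ
    have := hP θ (hball θ hθ).1.1
    have h1 := lintegral_increment_sq_le (ν := P θ) hg hbdd (θ₁ := θ₁) (u := τ n • e)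
      (fun s hs => (hball _ (hseg n s hs)).1.1)
      ((hUd θ (hball θ hθ).2).mono fun x hx s hs => hx _ (hball _ (hseg n s hs)).2)
      (fun s hs => hKle θ (hball θ hθ).2 _ (hball _ (hseg n s hs)).2) i
    rw [eLpNorm_two_eq]
    refine ENNReal.rpow_le_rpow ?_ (by norm_num)
    have hτe : ‖τ n • e‖ₑ = ‖τ n‖ₑ := by rw [enorm_smul, ← ofReal_norm e, hen]; simp
    have hτn : ‖τ n‖ₑ ≠ 0 := by simpa using (hτ0 n).ne'
    rw [hτe] at h1
    have e1 : ∀ x, ‖q n x‖ₑ ^ 2 = ‖(g x (θ₁ + τ n • e) - g x θ₁) i‖ₑ ^ 2 * (‖τ n‖ₑ ^ 2)⁻¹ := by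
      intro x
      simp only [q, div_eq_mul_inv]
      rw [enorm_mul, enorm_inv (hτ0 n).ne', mul_pow, ENNReal.inv_pow]
    simp only [e1]
    rw [lintegral_mul_const' _ _ (by simp [(hτ0 n).ne']), ← div_eq_mul_inv]
    exact ENNReal.div_le_of_le_mul h1
  have hqae : ∀ᵐ x ∂(P θ₁), Tendsto (fun n => q n x) atTop (𝓝 (jacobian (g x) θ₁ i j)) := by
    filter_upwards [hUd θ₁ (hball _ hself).2] with x hx
    have h1 : HasDerivAt (fun s : ℝ => g x (θ₁ + s • e) i) (jacobian (g x) θ₁ i j) 0 := by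
      have h1 : HasDerivAt (fun s : ℝ => θ₁ + s • e) e 0 := by
        simpa using ((hasDerivAt_id (0 : ℝ)).smul_const e).const_add θ₁
      have h0 : HasFDerivAt (g x) (fderiv ℝ (g x) θ₁) (θ₁ + (0 : ℝ) • e) := by
        simpa using (hx θ₁ (hball _ hself).2).hasFDerivAt
      have h2 := h0.comp_hasDerivAt (0 : ℝ) h1
      exact (EuclideanSpace.proj (𝕜 := ℝ) i : Euc d →L[ℝ] ℝ).hasFDerivAt.comp_hasDerivAt _ h2
    have h2 : Tendsto τ atTop (𝓝[≠] 0) :=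
      tendsto_nhdsWithin_iff.2 ⟨hτlim, Eventually.of_forall fun n => (hτ0 n).ne'⟩
    refine ((hasDerivAt_iff_tendsto_slope_zero.1 h1).comp h2).congr fun n => ?_
    simp [q, div_eq_inv_mul]
  -- the prediction error
  let a : X → ℝ := fun x => (p x - g x θ₁) i
  have ham : Measurable a := measurable_coord (hp.sub (hg _ hθ₁)) i
  -- Under the shifted measure the first term has mean zero by unbiasedness and an `L²` norm
  -- controlled by efficiency. This gives both the identity to differentiate and the bound on `a`.
  have hadec : ∀ n x, a x = (p x - g x (θ₁ + τ n • e)) i + τ n * q n x := fun n x => by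
    have := (hτ0 n).ne'
    simp only [a, q, PiLp.sub_apply]
    field_simp
    ring
  -- By efficiency the error is the continuous function `G I⁻¹ G'` of the parameter, hence bounded
  -- along a sequence converging in `Θ`.
  obtain ⟨R, hR⟩ : ∃ R : ℝ, ∀ n, √(quadraticError P g p (θ₁ + τ n • e) i i) ≤ R := by
    have hc : ContinuousOn (fun θ => √((meanJacobian P g θ * (fisherInfo P ℓ θ)⁻¹
        * (meanJacobian P g θ)ᵀ) i i)) Θ := by
      have h1 : ContinuousOn (fun θ => meanJacobian P g θ * (fisherInfo P ℓ θ)⁻¹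
          * (meanJacobian P g θ)ᵀ) Θ :=
        (hG_cont.mul (continuousOn_matrix_inv hI_cont
          fun θ hθ => (hreg θ hθ).fisherInfo_isUnit)).mul
          (continuous_id.matrix_transpose.comp_continuousOn hG_cont)
      exact ((continuous_apply_apply i i).comp_continuousOn h1).sqrt
    have h2 : Tendsto (fun n => θ₁ + τ n • e) atTop (𝓝 θ₁) := by
      simpa using (hτlim.smul_const e).const_add θ₁
    have h3 := ((hc.continuousAt (hΘ_open.mem_nhds hθ₁)).tendsto.comp h2).bddAbove_range
    obtain ⟨R, hR⟩ := h3
    refine ⟨R, fun n => ?_⟩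
    rw [(heff _ (hball _ (hend n)).1.1).2]
    exact hR ⟨n, rfl⟩
  have hpn : ∀ n, MemLp (fun x => (p x - g x (θ₁ + τ n • e)) i) 2 (P (θ₁ + τ n • e)) :=
    fun n => memLp_coord (heff _ (hball _ (hend n)).1.1).1 i
  have haP : ∀ n, eLpNorm a 2 (P (θ₁ + τ n • e)) ≤
      ENNReal.ofReal R + ENNReal.ofReal r * K ^ (1 / 2 : ℝ) := by
    intro n
    have e1 : a = (fun x => (p x - g x (θ₁ + τ n • e)) i) + τ n • q n := by
      ext x; exact hadec n x
    rw [e1]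
    refine (eLpNorm_add_le (hpn n).1 ((hqm n).const_smul _).aestronglyMeasurable
      (by norm_num)).trans (add_le_add ?_ ?_)
    · rw [eLpNorm_two_eq_ofReal_sqrt (hpn n)]
      refine ENNReal.ofReal_le_ofReal (le_trans (le_of_eq ?_) (hR n))
      simp [quadraticError, pow_two]
    · rw [eLpNorm_const_smul, Real.enorm_eq_ofReal (hτ0 n).le]
      gcongr
      exacts [(hτr n).le, hqK n _ (hend n)]
  set C : ℝ≥0∞ := ENNReal.ofReal R + ENNReal.ofReal r * K ^ (1 / 2 : ℝ) + K ^ (1 / 2 : ℝ) with hC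
  have hKfin : K ^ (1 / 2 : ℝ) ≠ ∞ := ENNReal.rpow_ne_top_of_nonneg (by norm_num) hUK.ne
  have hCfin : C ≠ ∞ := by
    rw [hC]; finiteness
  have hmean : ∀ θ ∈ Θ, ∫ x, (p x - g x θ) i ∂(P θ) = 0 := by
    intro θ hθ
    obtain ⟨h1, h2, h3⟩ := hunb θ hθ
    have h12 : Integrable (fun x => p x - g x θ) (P θ) := h1.sub h2
    rw [integral_coord h12 i, integral_sub h1 h2, h3, sub_self]
    rfl
  refine integral_mul_score_eq_of_root_expansion (μ := P θ₁) (S := fun n => S (ns n))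
    (q := fun n => q (ns n)) (a := a) (t := fun n => τ (ns n)) hCfin (fun n => (hτ0 _).ne')
    (fun n => hSL _) hl (memLp_coord (heff θ₁ hθ₁).1 i) (hS1.comp hns.tendsto_atTop)
    (hexp.comp hns.tendsto_atTop) hSae (fun n => ?_) (fun n => (hqm _).aestronglyMeasurable)
    (fun n => ?_) (fun n => ?_) ?_ (hmean θ₁ hθ₁) (fun n => ?_)
  · rw [eLpNorm_mul_rootDensity (hac _) ham.aestronglyMeasurable]
    exact (haP _).trans le_self_add
  · exact (hqK _ _ hself).trans le_add_self
  · rw [eLpNorm_mul_rootDensity (hac _) (hqm _).aestronglyMeasurable]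
    exact (hqK _ _ (hend _)).trans le_add_self
  · filter_upwards [hqae] with x hx using hx.comp hns.tendsto_atTop
  · have hqi : Integrable (q (ns n)) (P (θ₁ + τ (ns n) • e)) :=
      (memLp_two_of_eLpNorm_le hKfin (hqm _).aestronglyMeasurable (hqK _ _ (hend _))).integrable
        (by norm_num)
    simp only [S]
    rw [integral_mul_rootDensity_sq (hac _), integral_mul_rootDensity_sq (hac _),
      integral_congr_ae (Eventually.of_forall (hadec (ns n))),
      integral_add ((hpn _).integrable (by norm_num)) (hqi.const_mul _),
      hmean _ (hball _ (hend _)).1.1, zero_add, integral_const_mul]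

/-- Equality in the Cramér–Rao inequality determines the score: it is the linear image
`I(θ) G(θ)⁻¹ (p(X) - g(X, θ))` of the prediction error. -/
lemma score_eq_of_isEfficient (hΘ_open : IsOpen Θ)
    (hP : ∀ θ ∈ Θ, IsProbabilityMeasure (P θ))
    (hg : ∀ θ ∈ Θ, Measurable fun x => g x θ) (hp : Measurable p)
    (hreg : ∀ θ ∈ Θ, RegularAt P Θ ℓ g p θ) (hunb : IsUnbiased P Θ g p)
    (heff : IsEfficient P Θ ℓ g p) (hG : ∀ θ ∈ Θ, IsUnit (meanJacobian P g θ))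
    (hbdd : ∀ x, ∀ C' : Set (Euc d), IsCompact C' → C' ⊆ Θ →
      ∃ M : ℝ, ∀ θ ∈ C', DifferentiableAt ℝ (g x) θ → ‖fderiv ℝ (g x) θ‖ ≤ M)
    (hI_cont : ContinuousOn (fisherInfo P ℓ) Θ)
    (hG_cont : ContinuousOn (meanJacobian P g) Θ) {θ : Euc d} (hθ : θ ∈ Θ) :
    ∀ᵐ x ∂(P θ), ℓ θ x = WithLp.toLp 2
      ((fisherInfo P ℓ θ * (meanJacobian P g θ)⁻¹) *ᵥ (p x - g x θ).ofLp) := by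
  have hIu := (hreg θ hθ).fisherInfo_isUnit
  have hIdet := (Matrix.isUnit_iff_isUnit_det _).1 hIu
  have hGdet := (Matrix.isUnit_iff_isUnit_det _).1 (hG θ hθ)
  set G := meanJacobian P g θ with hGdef
  set I := fisherInfo P ℓ θ with hIdef
  have hY : ∀ i, MemLp (fun x => (p x - g x θ) i) 2 (P θ) := memLp_coord (heff θ hθ).1
  have hl : ∀ i, MemLp (fun x => ℓ θ x i) 2 (P θ) :=
    memLp_coord (hreg θ hθ).hasL2DerivAt.memLp
  have hcov : ∀ i j, ∫ x, (p x - g x θ) i * ℓ θ x j ∂(P θ) = G i j := fun i j =>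
    integral_error_mul_score_eq_meanJacobian hΘ_open hP hg hp hreg hunb heff hbdd hI_cont
      hG_cont hθ i j
  -- Expanding the square of the difference, all three second moments equal `(G I⁻¹ G') i i`, so its
  -- integral is `1 - 2 + 1 = 0` times that entry.
  have hzero : ∀ i, ∀ᵐ x ∂(P θ), (p x - g x θ) i = ∑ j, (G * I⁻¹) i j * ℓ θ x j := by
    intro i
    set M := G * I⁻¹ with hM
    have hZ : MemLp (fun x => ∑ j, M i j * ℓ θ x j) 2 (P θ) :=
      memLp_finsetSum _ fun j _ => (hl j).const_mul _
    have hYZ : MemLp (fun x => (p x - g x θ) i - ∑ j, M i j * ℓ θ x j) 2 (P θ) :=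
      (hY i).sub hZ
    have e1 : ∫ x, (p x - g x θ) i * (p x - g x θ) i ∂(P θ) = (G * I⁻¹ * Gᵀ) i i := by
      rw [← (heff θ hθ).2]; rfl
    have e2 : ∫ x, (p x - g x θ) i * ∑ j, M i j * ℓ θ x j ∂(P θ) = (G * I⁻¹ * Gᵀ) i i := by
      simp only [Finset.mul_sum]
      rw [integral_finsetSum]
      · rw [Matrix.mul_apply]
        refine Finset.sum_congr rfl fun j _ => ?_
        rw [Matrix.transpose_apply, ← hcov i j, ← integral_const_mul]
        congr 1; ext x; ring
      · exact fun j _ => (hY i).integrable_mul ((hl j).const_mul _)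
    have e3 : ∫ x, (∑ j, M i j * ℓ θ x j) * ∑ k, M i k * ℓ θ x k ∂(P θ)
        = (G * I⁻¹ * Gᵀ) i i := by
      have h1 : ∫ x, (∑ j, M i j * ℓ θ x j) * ∑ k, M i k * ℓ θ x k ∂(P θ)
          = (M * I * Mᵀ) i i := by
        have h2 : ∀ j k, Integrable (fun x => M i j * ℓ θ x j * (M i k * ℓ θ x k)) (P θ) :=
          fun j k => ((hl j).const_mul _).integrable_mul ((hl k).const_mul _)
        simp only [Finset.sum_mul_sum]
        rw [integral_finsetSum _ fun j _ => integrable_finsetSum _ fun k _ => h2 j k]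
        have h3 : ∀ j, ∫ x, ∑ k, M i j * ℓ θ x j * (M i k * ℓ θ x k) ∂(P θ)
            = ∑ k, M i j * I j k * M i k := fun j => by
          rw [integral_finsetSum _ fun k _ => h2 j k]
          refine Finset.sum_congr rfl fun k _ => ?_
          have h4 : I j k = ∫ x, ℓ θ x j * ℓ θ x k ∂(P θ) := rfl
          rw [h4, mul_right_comm, ← integral_const_mul]
          congr 1; ext x; ring
        simp only [h3, Matrix.mul_apply, Finset.sum_mul, Matrix.transpose_apply]
        exact Finset.sum_comm
      -- A diagonal entry is unchanged by transposition, which spares the symmetry of `I`.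
      rw [h1, hM, Matrix.mul_assoc G, Matrix.nonsing_inv_mul _ hIdet, Matrix.mul_one,
        ← Matrix.transpose_apply (G * (G * I⁻¹)ᵀ), Matrix.transpose_mul,
        Matrix.transpose_transpose]
    have hint : ∫ x, ((p x - g x θ) i - ∑ j, M i j * ℓ θ x j) ^ 2 ∂(P θ) = 0 := by
      have i1 : Integrable (fun x => (p x - g x θ) i * (p x - g x θ) i) (P θ) :=
        (hY i).integrable_mul (hY i)
      have i2 : Integrable (fun x => (p x - g x θ) i * ∑ j, M i j * ℓ θ x j) (P θ) :=
        (hY i).integrable_mul hZ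
      have i3 : Integrable
          (fun x => (∑ j, M i j * ℓ θ x j) * ∑ k, M i k * ℓ θ x k) (P θ) :=
        hZ.integrable_mul hZ
      have i4 : Integrable (fun x => (p x - g x θ) i * (p x - g x θ) i
          - 2 * ((p x - g x θ) i * ∑ j, M i j * ℓ θ x j)) (P θ) := i1.sub (i2.const_mul 2)
      calc _ = ∫ x, ((p x - g x θ) i * (p x - g x θ) i
            - 2 * ((p x - g x θ) i * ∑ j, M i j * ℓ θ x j)
            + (∑ j, M i j * ℓ θ x j) * ∑ k, M i k * ℓ θ x k) ∂(P θ) := by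
              congr 1; ext x; ring
        _ = 0 := by
              rw [integral_add i4 i3, integral_sub i1 (i2.const_mul 2), integral_const_mul,
                e1, e2, e3]
              ring
    have h0 := (integral_eq_zero_iff_of_nonneg (fun x => sq_nonneg _) hYZ.integrable_sq).1 hint
    filter_upwards [h0] with x hx
    have := pow_eq_zero_iff (two_ne_zero) |>.1 hx
    linarith
  filter_upwards [ae_all_iff.2 hzero] with x hx
  have hv : (p x - g x θ).ofLp = (G * I⁻¹) *ᵥ (ℓ θ x).ofLp := by
    ext i; exact hx i
  rw [hv, Matrix.mulVec_mulVec, Matrix.mul_assoc, Matrix.nonsing_inv_mul_cancel_left _ _ hGdet,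
    Matrix.mul_nonsing_inv _ hIdet, Matrix.one_mulVec]

end CramerRao

end Prediction

/-! ### Transport of root densities along segments -/

namespace Prediction

section Segment

variable {X : Type*} [MeasurableSpace X] {d : ℕ} {P : Euc d → Measure X} {Θ W : Set (Euc d)}
  {ℓ : Euc d → X → Euc d}

lemma integral_abs_le_of_eLpNorm_two_le {μ : Measure X} [IsProbabilityMeasure μ] {h : X → ℝ}
    (hh : AEStronglyMeasurable h μ) {c : ℝ} (hc0 : 0 ≤ c)
    (hc : eLpNorm h 2 μ ≤ ENNReal.ofReal c) : ∫ x, |h x| ∂μ ≤ c := by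
  have hmem : MemLp h 2 μ := memLp_two_of_eLpNorm_le ENNReal.ofReal_ne_top hh hc
  rw [← ENNReal.ofReal_le_ofReal_iff hc0]
  have := ofReal_integral_norm_eq_lintegral_enorm (hmem.integrable (by norm_num))
  simp only [Real.norm_eq_abs] at this
  rw [this, ← eLpNorm_one_eq_lintegral_enorm]
  exact (eLpNorm_le_eLpNorm_of_exponent_le (by norm_num) hh).trans hc

/-- If the score has a version `F` that is continuous in the parameter, the root density is
transported along segments by the exponential of the line integral of `F / 2`. -/
lemma rootDensity_eq_mul_exp_segment {μ : Measure X} [IsProbabilityMeasure μ]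
    (hW : Convex ℝ W) (hP : ∀ θ ∈ W, IsProbabilityMeasure (P θ)) (hac : ∀ θ ∈ W, P θ ≪ μ)
    (hL : ∀ θ ∈ W, HasL2DerivAt P Θ θ (ℓ θ)) {F : X → Euc d → Euc d}
    (hFm : ∀ θ ∈ W, Measurable fun x => F x θ) (hFc : ∀ᵐ x ∂μ, ContinuousOn (F x) W)
    (hscore : ∀ θ ∈ W, ∀ᵐ x ∂(P θ), ℓ θ x = F x θ) {θ θ' : Euc d} (hθ : θ ∈ W) (hθ' : θ' ∈ W) :
    ∀ᵐ x ∂μ, rootDensity (P θ') μ x = rootDensity (P θ) μ x *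
      Real.exp (∫ r in (0 : ℝ)..1, 1 / 2 * ⟪θ' - θ, F x (θ + r • (θ' - θ))⟫) := by
  obtain ⟨Z, hZsub, hZm, hZμ⟩ :
      ∃ Z, {x | ¬ ContinuousOn (F x) W} ⊆ Z ∧ MeasurableSet Z ∧ μ Z = 0 :=
    exists_measurable_superset_of_null hFc
  have hgood : ∀ x ∉ Z, ContinuousOn (F x) W := fun x hx => by
    by_contra h
    exact hx (hZsub h)
  have hZae : ∀ᵐ x ∂μ, x ∉ Z := measure_eq_zero_iff_ae_notMem.1 hZμ
  set v := θ' - θ with hv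
  let γ : ℝ → Euc d := fun t => θ + t • v
  have hγc : Continuous γ := by fun_prop
  have hγ : ∀ t ∈ Set.Icc (0 : ℝ) 1, γ t ∈ W := fun t ht =>
    hW.add_smul_sub_mem hθ hθ' ht
  let π : ℝ → ℝ := fun t => Set.projIcc (0 : ℝ) 1 zero_le_one t
  have hπc : Continuous π := continuous_subtype_val.comp continuous_projIcc
  have hπm : ∀ t, π t ∈ Set.Icc (0 : ℝ) 1 := fun t => (Set.projIcc (0 : ℝ) 1 zero_le_one t).2
  have hπ : ∀ t ∈ Set.Icc (0 : ℝ) 1, π t = t := fun t ht => by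
    simp only [π, Set.projIcc_of_mem zero_le_one ht]
  -- The clamp `π` and the cut-off on `Z` give a coefficient that is continuous and bounded in time
  -- for every `x`.
  let f : ℝ → X → ℝ := fun t => Zᶜ.indicator fun x => 1 / 2 * ⟪v, F x (γ (π t))⟫
  have hfm : ∀ t, Measurable (f t) := fun t =>
    ((((hFm _ (hγ _ (hπm t))).const_inner).const_mul _)).indicator hZm.compl
  have hfc : ∀ x, Continuous fun t => f t x := fun x => by
    by_cases hx : x ∈ Z
    · simpa [f, hx] using continuous_const
    · simp only [f, Set.indicator_of_mem (show x ∈ Zᶜ from hx)]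
      have h1 : Continuous fun t => F x (γ (π t)) :=
        (hgood x hx).comp_continuous (hγc.comp hπc) fun t => hγ _ (hπm t)
      exact continuous_const.mul (continuous_const.inner h1)
  have hfb : ∀ x, ∃ M : ℝ, ∀ t, |f t x| ≤ M := fun x => by
    obtain ⟨M, hM⟩ := isCompact_Icc.exists_bound_of_continuousOn
      (s := Set.Icc (0 : ℝ) 1) (hfc x).continuousOn
    refine ⟨M, fun t => ?_⟩
    have h1 : f t x = f (π t) x := by simp only [f, hπ _ (hπm t)]
    rw [h1]
    exact hM _ (hπm t)
  have hfeq : ∀ t ∈ Set.Icc (0 : ℝ) 1, ∀ᵐ x ∂(P (γ t)), 1 / 2 * ⟪v, ℓ (γ t) x⟫ = f t x := by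
    intro t ht
    filter_upwards [hscore _ (hγ t ht), (hac _ (hγ t ht)).ae_le hZae] with x hx hxZ
    simp only [f, Set.indicator_of_mem (show x ∈ Zᶜ from hxZ), hπ t ht, hx]
  let s : ℝ → X → ℝ := fun t => rootDensity (P (γ t)) μ
  have hs : ∀ t ∈ Set.Icc (0 : ℝ) 1, Integrable (s t) μ := fun t ht => by
    have := hP _ (hγ t ht)
    exact (memLp_rootDensity (hac _ (hγ t ht))).integrable (by norm_num)
  have hfs : ∀ t ∈ Set.Icc (0 : ℝ) 1, Integrable (fun x => f t x * s t x) μ := fun t ht => by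
    have := hP _ (hγ t ht)
    have h1 : MemLp (f t) 2 (P (γ t)) :=
      (((hL _ (hγ t ht)).memLp.const_inner v).const_mul (1 / 2)).ae_eq (hfeq t ht)
    have h2 : MemLp (fun x => f t x * s t x) 2 μ := by
      refine ⟨((hfm t).mul (measurable_rootDensity _ _)).aestronglyMeasurable, ?_⟩
      rw [eLpNorm_mul_rootDensity (hac _ (hγ t ht)) (hfm t).aestronglyMeasurable]
      exact h1.2
    exact h2.integrable (by norm_num)
  -- The `L²(P (γ t))` expansion at `γ t`, multiplied by the root density of `P (γ t)`, becomes an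
  -- `L²(μ)` expansion by the isometry and the chain rule for densities; `L²` dominates `L¹` under a
  -- probability measure.
  have hsd : ∀ t ∈ Set.Icc (0 : ℝ) 1,
      (fun τ => ∫ x, |s τ x - s t x - (τ - t) * (f t x * s t x)| ∂μ)
        =o[𝓝[Set.Icc 0 1] t] fun τ => τ - t := by
    intro t ht
    have hPt := hP _ (hγ t ht)
    have hγτ : ∀ τ, γ t + (τ - t) • v = γ τ := fun τ => by
      simp only [γ]; module
    have hu : Tendsto (fun τ : ℝ => (τ - t) • v) (𝓝[Set.Icc 0 1] t) (𝓝 0) := by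
      have : Continuous fun τ : ℝ => (τ - t) • v := by fun_prop
      have h := this.tendsto t
      simp only [sub_self, zero_smul] at h
      exact h.mono_left nhdsWithin_le_nhds
    have h1 : (fun τ => √(∫ x, rootRemainder P (γ t) (ℓ (γ t)) ((τ - t) • v) x ^ 2 ∂(P (γ t))))
        =o[𝓝[Set.Icc 0 1] t] fun τ => τ - t := by
      refine ((hL _ (hγ t ht)).isLittleO_sqrt.comp_tendsto hu).trans_isBigO
        (IsBigO.of_bound ‖v‖ (Eventually.of_forall fun τ => ?_))
      simp [norm_smul, mul_comm]
    refine IsBigO.trans_isLittleO (IsBigO.of_bound 1 ?_) h1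
    have hev : ∀ᶠ τ in 𝓝[Set.Icc 0 1] t, P (γ τ) ≪ P (γ t) :=
      ((hγc.tendsto t).eventually (hL _ (hγ t ht)).eventually_absolutelyContinuous).filter_mono
        nhdsWithin_le_nhds |>.mono fun τ h => h.2
    filter_upwards [hev, self_mem_nhdsWithin] with τ hτac hτ
    have hPτ := hP _ (hγ τ hτ)
    have hPτ' : IsProbabilityMeasure (P (γ t + (τ - t) • v)) := by rw [hγτ]; exact hPτ
    rw [one_mul, Real.norm_of_nonneg (integral_nonneg fun _ => abs_nonneg _),
      Real.norm_of_nonneg (Real.sqrt_nonneg _)]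
    refine integral_abs_le_of_eLpNorm_two_le ?_ (Real.sqrt_nonneg _) ?_
    · exact (((hs τ hτ).sub (hs t ht)).sub ((hfs t ht).const_mul _)).1
    let R : X → ℝ := fun x => rootDensity (P (γ τ)) (P (γ t)) x - 1 - (τ - t) * f t x
    have hRm : Measurable R :=
      ((measurable_rootDensity _ _).sub_const 1).sub ((hfm t).const_mul _)
    have hRR : R =ᵐ[P (γ t)] rootRemainder P (γ t) (ℓ (γ t)) ((τ - t) • v) := by
      filter_upwards [hfeq t ht] with x hx
      simp only [R, rootRemainder, hγτ, ← hx, real_inner_smul_left]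
      ring
    have hRs : (fun x => s τ x - s t x - (τ - t) * (f t x * s t x)) =ᵐ[μ]
        fun x => R x * rootDensity (P (γ t)) μ x := by
      filter_upwards [rootDensity_mul (μ := μ) hτac] with x hx
      simp only [s, R, hx]
      ring
    rw [eLpNorm_congr_ae hRs, eLpNorm_mul_rootDensity (hac _ (hγ t ht)) hRm.aestronglyMeasurable,
      eLpNorm_congr_ae hRR, eLpNorm_two_eq_ofReal_sqrt]
    exact memLp_rootRemainder (hL _ (hγ t ht)).memLp (by rw [hγτ]; exact hτac)
  filter_upwards [ae_eq_mul_exp_of_L1_hasDeriv hfc hfm hfb hs hfs hsd, hZae] with x hx hxZ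
  have e1 : s 1 x = rootDensity (P θ') μ x := by simp [s, γ, hv]
  have e0 : s 0 x = rootDensity (P θ) μ x := by simp [s, γ]
  rw [e1, e0] at hx
  rw [hx]
  congr 2
  refine intervalIntegral.integral_congr fun r hr => ?_
  rw [Set.uIcc_of_le zero_le_one] at hr
  simp only [f, Set.indicator_of_mem (show x ∈ Zᶜ from hxZ), hπ r hr, γ]

end Segment

end Prediction

/-! ### Line integrals and potentials -/

namespace Prediction

noncomputable section

section Potential

variable {d : ℕ}

/-- The line integral of the vector field `F` over the segment from `a` to `b`. -/
def lineIntegral (F : Euc d → Euc d) (a b : Euc d) : ℝ :=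
  ∫ r in (0 : ℝ)..1, ⟪b - a, F (a + r • (b - a))⟫

lemma lineIntegral_self (F : Euc d → Euc d) (a : Euc d) : lineIntegral F a a = 0 := by
  simp [lineIntegral]

lemma continuousOn_lineIntegral {F : Euc d → Euc d} {W : Set (Euc d)} (hW : Convex ℝ W)
    (hF : ContinuousOn F W) :
    ContinuousOn (fun y : Euc d × Euc d => lineIntegral F y.1 y.2) (W ×ˢ W) := by
  rw [continuousOn_iff_continuous_domRestrict]
  have hπ : ∀ r ∈ Set.Icc (0 : ℝ) 1, (Set.projIcc (0 : ℝ) 1 zero_le_one r : ℝ) = r :=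
    fun r hr => by rw [Set.projIcc_of_mem zero_le_one hr]
  have hc : Continuous (Function.uncurry fun (y : ↥(W ×ˢ W)) (r : ℝ) =>
      ⟪y.1.2 - y.1.1,
        F (y.1.1 + (Set.projIcc (0 : ℝ) 1 zero_le_one r : ℝ) • (y.1.2 - y.1.1))⟫) := by
    have h1 : Continuous fun z : ↥(W ×ˢ W) × ℝ => F (z.1.1.1
        + (Set.projIcc (0 : ℝ) 1 zero_le_one z.2 : ℝ) • (z.1.1.2 - z.1.1.1)) := by
      refine hF.comp_continuous ?_ fun z => ?_
      · have : Continuous fun r : ℝ => (Set.projIcc (0 : ℝ) 1 zero_le_one r : ℝ) :=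
          continuous_subtype_val.comp continuous_projIcc
        fun_prop
      · exact hW.add_smul_sub_mem z.1.2.1 z.1.2.2 (Set.projIcc (0 : ℝ) 1 zero_le_one z.2).2
    exact Continuous.inner (by fun_prop) h1
  refine (intervalIntegral.continuous_parametric_intervalIntegral_of_continuous'
    (μ := volume) hc 0 1).congr
    fun y => ?_
  refine intervalIntegral.integral_congr fun r hr => ?_
  rw [Set.uIcc_of_le zero_le_one] at hr
  simp only [hπ r hr]

lemma intervalIntegrable_inner_segment {F : Euc d → Euc d} {W : Set (Euc d)} (hW : Convex ℝ W)
    (hF : ContinuousOn F W) {a b : Euc d} (ha : a ∈ W) (hb : b ∈ W) (v : Euc d) :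
    IntervalIntegrable (fun r : ℝ => ⟪v, F (a + r • (b - a))⟫) volume 0 1 := by
  refine ContinuousOn.intervalIntegrable ?_
  rw [Set.uIcc_of_le zero_le_one]
  refine continuousOn_const.inner (hF.comp (by fun_prop) fun r hr => ?_)
  exact hW.add_smul_sub_mem ha hb hr

/-- A function whose increments near `θ` are the line integrals of a continuous field `F` has
gradient `F θ` at `θ`. -/
lemma hasGradientAt_of_sub_eq_lineIntegral {F : Euc d → Euc d} {H : Euc d → ℝ} {θ : Euc d}
    {r : ℝ} (hr : 0 < r) (hF : ContinuousOn F (Metric.ball θ r))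
    (hH : ∀ η ∈ Metric.ball θ r, H η - H θ = lineIntegral F θ η) : HasGradientAt H (F θ) θ := by
  rw [hasGradientAt_iff_isLittleO, isLittleO_iff]
  intro c hc
  have hcont : ContinuousAt F θ := hF.continuousAt (Metric.ball_mem_nhds θ hr)
  obtain ⟨δ, hδ, hball⟩ := Metric.continuousAt_iff.1 hcont c hc
  filter_upwards [Metric.ball_mem_nhds θ (lt_min hδ hr)] with η hη
  have hηr : η ∈ Metric.ball θ r := Metric.ball_subset_ball (min_le_right _ _) hη
  have hself : θ ∈ Metric.ball θ r := Metric.mem_ball_self hr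
  have e : H η - H θ - ⟪F θ, η - θ⟫ =
      ∫ s in (0 : ℝ)..1, (⟪η - θ, F (θ + s • (η - θ))⟫ - ⟪η - θ, F θ⟫) := by
    rw [intervalIntegral.integral_sub
      (intervalIntegrable_inner_segment (convex_ball θ r) hF hself hηr _)
      intervalIntegrable_const, hH η hηr, lineIntegral]
    simp [real_inner_comm]
  rw [e]
  have := intervalIntegral.norm_integral_le_of_norm_le_const (a := 0) (b := 1)
    (C := c * ‖η - θ‖) (f := fun s => ⟪η - θ, F (θ + s • (η - θ))⟫ - ⟪η - θ, F θ⟫) (by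
      intro s hs
      rw [Set.uIoc_of_le zero_le_one] at hs
      rw [← inner_sub_right]
      refine (norm_inner_le_norm _ _).trans ?_
      rw [mul_comm]
      refine mul_le_mul_of_nonneg_right ?_ (norm_nonneg _)
      rw [← dist_eq_norm]
      refine (hball ?_).le
      have h1 : η ∈ Metric.ball θ δ := Metric.ball_subset_ball (min_le_left _ _) hη
      exact (convex_ball θ δ).add_smul_sub_mem (Metric.mem_ball_self hδ) h1 ⟨hs.1.le, hs.2⟩)
  simpa using this

/-- A function on a dense subset of an open set whose increments over segments are the line
integrals of a continuous field extends to a potential of the field. No assumption on the topology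
of the open set is needed. -/
lemma potential_of_dense {Θ D : Set (Euc d)} (hΘ : IsOpen Θ) (hDΘ : Θ ⊆ closure D)
    {F : Euc d → Euc d} {h : Euc d → ℝ} (hF : ContinuousOn F Θ)
    (hh : ∀ q ∈ D, ∀ q' ∈ D, segment ℝ q q' ⊆ Θ → h q' - h q = lineIntegral F q q') :
    (∀ θ ∈ Θ, HasGradientAt (extendFrom D h) (F θ) θ) ∧
    ∀ θ ∈ Θ, (∀ q ∈ D, segment ℝ q θ ⊆ Θ → h θ - h q = lineIntegral F q θ) →
      extendFrom D h θ = h θ := by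
  -- The right side is continuous in `θ` and agrees with `h` on `D ∩ W`, so it is the limit that
  -- defines the extension.
  have key : ∀ W ⊆ Θ, IsOpen W → Convex ℝ W → ∀ q ∈ D, q ∈ W → ∀ θ ∈ W,
      extendFrom D h θ = h q + lineIntegral F q θ := by
    intro W hWΘ hWo hWc q hq hqW θ hθ
    refine extendFrom_eq (hDΘ (hWΘ hθ)) ?_
    have h1 : ContinuousAt (fun η => lineIntegral F q η) θ := by
      have h2 := (continuousOn_lineIntegral hWc (hF.mono hWΘ)).continuousAt
        (x := (q, θ)) ((hWo.prod hWo).mem_nhds ⟨hqW, hθ⟩)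
      exact h2.comp (f := fun η => (q, η)) (by fun_prop)
    have h3 : Tendsto (fun η => h q + lineIntegral F q η) (𝓝[D] θ)
        (𝓝 (h q + lineIntegral F q θ)) :=
      (h1.tendsto.const_add _).mono_left nhdsWithin_le_nhds
    refine h3.congr' ?_
    filter_upwards [self_mem_nhdsWithin, mem_nhdsWithin_of_mem_nhds (hWo.mem_nhds hθ)]
      with η hηD hηW
    have := hh q hq η hηD ((hWc.segment_subset hqW hηW).trans hWΘ)
    linarith
  have hbase : ∀ θ ∈ Θ, ∃ r > 0, Metric.ball θ r ⊆ Θ :=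
    fun θ hθ => Metric.isOpen_iff.1 hΘ θ hθ
  constructor
  · intro θ hθ
    obtain ⟨r, hr, hball⟩ := hbase θ hθ
    have hself : θ ∈ Metric.ball θ r := Metric.mem_ball_self hr
    refine hasGradientAt_of_sub_eq_lineIntegral hr (hF.mono hball) fun η hη => ?_
    -- The base point must lie in `D`, whereas the increment wanted starts at `θ`; hence `q ∈ D` is
    -- sent to `θ`.
    have hcont : ∀ ζ ∈ Metric.ball θ r, Tendsto (fun q => lineIntegral F q ζ) (𝓝[D] θ)
        (𝓝 (lineIntegral F θ ζ)) := by
      intro ζ hζ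
      have h2 := (continuousOn_lineIntegral (convex_ball θ r) (hF.mono hball)).continuousAt
        (x := (θ, ζ)) ((Metric.isOpen_ball.prod Metric.isOpen_ball).mem_nhds ⟨hself, hζ⟩)
      have h3 : ContinuousAt (fun q => lineIntegral F q ζ) θ :=
        h2.comp (f := fun q => (q, ζ)) (by fun_prop)
      exact h3.tendsto.mono_left nhdsWithin_le_nhds
    have hlim := (hcont η hη).sub (hcont θ hself)
    rw [lineIntegral_self, sub_zero] at hlim
    have : (𝓝[D] θ).NeBot := mem_closure_iff_nhdsWithin_neBot.1 (hDΘ hθ)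
    refine tendsto_nhds_unique (tendsto_const_nhds.congr' ?_) hlim
    filter_upwards [self_mem_nhdsWithin,
      mem_nhdsWithin_of_mem_nhds (Metric.ball_mem_nhds θ hr)] with q hqD hqW
    rw [key _ hball Metric.isOpen_ball (convex_ball θ r) q hqD hqW η hη,
      key _ hball Metric.isOpen_ball (convex_ball θ r) q hqD hqW θ hself]
    ring
  · intro θ hθ hθh
    obtain ⟨r, hr, hball⟩ := hbase θ hθ
    have hself : θ ∈ Metric.ball θ r := Metric.mem_ball_self hr
    obtain ⟨q, hqW, hqD⟩ := mem_closure_iff.1 (hDΘ hθ) _ Metric.isOpen_ball hself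
    rw [key _ hball Metric.isOpen_ball (convex_ball θ r) q hqD hqW θ hself,
      ← hθh q hqD (((convex_ball θ r).segment_subset hqW hself).trans hball)]
    ring

lemma fderiv_apply_eq_jacobian_mulVec (A : Euc d → Euc d) (θ u : Euc d) :
    (fderiv ℝ A θ u).ofLp = jacobian A θ *ᵥ u.ofLp := by
  have hu : u = ∑ j, u j • EuclideanSpace.single j (1 : ℝ) := by
    ext i
    simp [Finset.sum_apply, Pi.single_apply]
  ext i
  conv_lhs => rw [hu]
  simp [jacobian, Matrix.mulVec, dotProduct, mul_comm]

lemma hasGradientAt_inner_const {A : Euc d → Euc d} {θ : Euc d} (hA : DifferentiableAt ℝ A θ)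
    (c : Euc d) :
    HasGradientAt (fun θ => ⟪A θ, c⟫) (WithLp.toLp 2 ((jacobian A θ)ᵀ *ᵥ c.ofLp)) θ := by
  rw [hasGradientAt_iff_hasFDerivAt]
  refine (hA.hasFDerivAt.inner ℝ (hasFDerivAt_const c θ)).congr_fderiv ?_
  ext1 u
  simp [EuclideanSpace.inner_eq_star_dotProduct, fderiv_apply_eq_jacobian_mulVec]
  rw [Matrix.dotProduct_mulVec, Matrix.mulVec_transpose, dotProduct_comm]

end Potential

end

end Prediction

/-! ### The score field and the log-likelihood -/

namespace Prediction

noncomputable section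

variable {X : Type*} {d : ℕ} {g : X → Euc d → Euc d} {p : X → Euc d} {A : Euc d → Euc d}

/-- The field `(J_θ A)' (p(x) - g(x, θ))`, the version of the score given by efficiency. -/
def scoreField (A : Euc d → Euc d) (g : X → Euc d → Euc d) (p : X → Euc d) (x : X)
    (θ : Euc d) : Euc d :=
  WithLp.toLp 2 ((jacobian A θ)ᵀ *ᵥ (p x - g x θ).ofLp)

lemma measurable_scoreField [MeasurableSpace X] (hp : Measurable p) {θ : Euc d}
    (hg : Measurable fun x => g x θ) :
    Measurable fun x => scoreField A g p x θ := by
  have hc : Continuous fun y : Euc d => WithLp.toLp 2 ((jacobian A θ)ᵀ *ᵥ y.ofLp) := by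
    have := (continuous_const (y := (jacobian A θ)ᵀ)).matrix_mulVec
      (PiLp.continuous_ofLp 2 fun _ : Fin d => ℝ)
    exact (PiLp.continuous_toLp 2 fun _ : Fin d => ℝ).comp this
  exact hc.measurable.comp (hp.sub hg)

lemma continuousOn_scoreField {W : Set (Euc d)} {x : X}
    (hJ : ContinuousOn (fun θ => (jacobian A θ)ᵀ) W) (hg : ContinuousOn (g x) W) :
    ContinuousOn (scoreField A g p x) W := by
  have hc : Continuous fun y : Matrix (Fin d) (Fin d) ℝ × Euc d =>
      WithLp.toLp 2 (y.1 *ᵥ y.2.ofLp) := by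
    have := continuous_fst.matrix_mulVec (A := fun y : Matrix (Fin d) (Fin d) ℝ × Euc d => y.1)
      ((PiLp.continuous_ofLp 2 fun _ : Fin d => ℝ).comp continuous_snd)
    exact (PiLp.continuous_toLp 2 fun _ : Fin d => ℝ).comp this
  exact hc.comp_continuousOn (hJ.prodMk (continuousOn_const.sub hg))

variable [MeasurableSpace X] {P : Euc d → Measure X} {Θ : Set (Euc d)} {ℓ : Euc d → X → Euc d}

/-- Near every parameter the measures are mutually absolutely continuous. -/
lemma eventually_mutually_absolutelyContinuous
    (hP : ∀ θ ∈ Θ, IsProbabilityMeasure (P θ))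
    (hL : ∀ θ ∈ Θ, HasL2DerivAt P Θ θ (ℓ θ)) {F : X → Euc d → Euc d}
    (hFm : ∀ θ ∈ Θ, Measurable fun x => F x θ)
    (hscore : ∀ θ ∈ Θ, ∀ᵐ x ∂(P θ), ℓ θ x = F x θ) {θ : Euc d} (hθ : θ ∈ Θ)
    {U : Set (Euc d)} (hU : U ∈ 𝓝 θ) (hFc : ∀ᵐ x ∂(P θ), ContinuousOn (F x) U) :
    ∀ᶠ η in 𝓝 θ, P η ≪ P θ ∧ P θ ≪ P η := by
  obtain ⟨r, hr, hball⟩ := Metric.eventually_nhds_iff_ball.1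
    ((hL θ hθ).eventually_absolutelyContinuous.and hU)
  have hself : θ ∈ Metric.ball θ r := Metric.mem_ball_self hr
  have := hP θ hθ
  filter_upwards [Metric.ball_mem_nhds θ hr] with η hη
  have hPη := hP η (hball η hη).1.1
  have hac := (hball η hη).1.2
  refine ⟨hac, ?_⟩
  have hseg := rootDensity_eq_mul_exp_segment (μ := P θ) (convex_ball θ r)
    (fun ζ hζ => hP ζ (hball ζ hζ).1.1) (fun ζ hζ => (hball ζ hζ).1.2)
    (fun ζ hζ => hL ζ (hball ζ hζ).1.1) (fun ζ hζ => hFm ζ (hball ζ hζ).1.1)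
    (hFc.mono fun x hx => hx.mono fun ζ hζ => (hball ζ hζ).2)
    (fun ζ hζ => hscore ζ (hball ζ hζ).1.1) hself hη
  -- The density of `P θ` with respect to itself is `1`, so the root density of `P η` is a pure
  -- exponential and cannot vanish.
  have hne : ∀ᵐ x ∂(P θ), (P η).rnDeriv (P θ) x ≠ 0 := by
    filter_upwards [hseg, Measure.rnDeriv_self (P θ)] with x hx h1 h0
    simp only [rootDensity, h0, h1, ENNReal.toReal_zero, Real.sqrt_zero,
      ENNReal.toReal_one, Real.sqrt_one, one_mul] at hx
    exact (Real.exp_pos _).ne hx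
  have h := withDensity_absolutelyContinuous' (Measure.measurable_rnDeriv _ _).aemeasurable hne
  rwa [Measure.withDensity_rnDeriv_eq _ _ hac] at h

/-- The increments of the log-likelihood over a segment are the line integrals of the score. -/
lemma log_rnDeriv_sub_eq_lineIntegral {μ : Measure X} [IsProbabilityMeasure μ]
    (hP : ∀ θ ∈ Θ, IsProbabilityMeasure (P θ)) (hac : ∀ θ ∈ Θ, P θ ≪ μ ∧ μ ≪ P θ)
    (hL : ∀ θ ∈ Θ, HasL2DerivAt P Θ θ (ℓ θ)) {F : X → Euc d → Euc d}
    (hFm : ∀ θ ∈ Θ, Measurable fun x => F x θ) (hFc : ∀ᵐ x ∂μ, ContinuousOn (F x) Θ)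
    (hscore : ∀ θ ∈ Θ, ∀ᵐ x ∂(P θ), ℓ θ x = F x θ) {a b : Euc d} (hab : segment ℝ a b ⊆ Θ) :
    ∀ᵐ x ∂μ, Real.log ((P b).rnDeriv μ x).toReal - Real.log ((P a).rnDeriv μ x).toReal
      = lineIntegral (F x) a b := by
  have ha : a ∈ segment ℝ a b := left_mem_segment ℝ a b
  have hb : b ∈ segment ℝ a b := right_mem_segment ℝ a b
  have hPa := hP a (hab ha)
  have hPb := hP b (hab hb)
  filter_upwards [rootDensity_eq_mul_exp_segment (μ := μ) (convex_segment a b)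
    (fun ζ hζ => hP ζ (hab hζ)) (fun ζ hζ => (hac ζ (hab hζ)).1)
    (fun ζ hζ => hL ζ (hab hζ)) (fun ζ hζ => hFm ζ (hab hζ))
    (hFc.mono fun x hx => hx.mono hab)
    (fun ζ hζ => hscore ζ (hab hζ)) ha hb, Measure.rnDeriv_pos' (hac a (hab ha)).2,
    Measure.rnDeriv_lt_top (P a) μ] with x hx hpos hlt
  have hpos' : 0 < ((P a).rnDeriv μ x).toReal := ENNReal.toReal_pos hpos.ne' hlt.ne
  -- Squaring the root density cancels the factor `1 / 2` in the exponent.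
  rw [← rootDensity_sq, hx, mul_pow, rootDensity_sq, ← Real.exp_nat_mul,
    Real.log_mul hpos'.ne' (Real.exp_pos _).ne', Real.log_exp,
    intervalIntegral.integral_const_mul, lineIntegral]
  push_cast
  ring

end

end Prediction

/-! ### The exponential family -/

open Prediction in
theorem mainTheorem3 {X : Type*} [MeasurableSpace X] [TopologicalSpace X] [SigmaCompactSpace X]
    {d : ℕ} (Θ : Set (Euc d)) (hΘ_open : IsOpen Θ) (hΘ_conn : IsConnected Θ)
    (P : Euc d → Measure X) (hP : ∀ θ ∈ Θ, IsProbabilityMeasure (P θ))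
    (ℓ : Euc d → X → Euc d)
    (g : X → Euc d → Euc d) (hg : ∀ θ ∈ Θ, Measurable fun x => g x θ)
    (p : X → Euc d) (hp : Measurable p)
    (hreg : ∀ θ ∈ Θ, RegularAt P Θ ℓ g p θ)
    (hunb : IsUnbiased P Θ g p)
    (heff : IsEfficient P Θ ℓ g p)
    (hG : ∀ θ ∈ Θ, IsUnit (meanJacobian P g θ))
    (A : Euc d → Euc d) (hA : ∀ θ ∈ Θ, DifferentiableAt ℝ A θ)
    (hJA : ∀ θ ∈ Θ, (jacobian A θ)ᵀ = fisherInfo P ℓ θ * (meanJacobian P g θ)⁻¹)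
    (hbdd : ∀ C : Set X, IsCompact C → ∀ C' : Set (Euc d), IsCompact C' → C' ⊆ Θ →
      ∃ M : ℝ, ∀ x ∈ C, ∀ θ ∈ C', DifferentiableAt ℝ (g x) θ → ‖fderiv ℝ (g x) θ‖ ≤ M)
    (hI_cont : ContinuousOn (fisherInfo P ℓ) Θ)
    (hG_cont : ContinuousOn (meanJacobian P g) Θ)
    (θ₀ : Euc d) (hθ₀ : θ₀ ∈ Θ) :
    ∃ B : X → Euc d → ℝ,
      (∀ x, ∀ θ ∈ Θ, DifferentiableAt ℝ (B x) θ) ∧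
      (∀ θ ∈ Θ, P θ ≪ P θ₀ ∧
        ∀ᵐ x ∂(P θ₀), (P θ).rnDeriv (P θ₀) x =
          ENNReal.ofReal (Real.exp (⟪A θ, p x⟫ - B x θ))) ∧
      (∀ᵐ x ∂(P θ₀), ∀ θ ∈ Θ,
        HasGradientAt (B x) (WithLp.toLp 2 ((jacobian A θ)ᵀ *ᵥ (g x θ).ofLp)) θ) := by
  classical
  have hL : ∀ θ ∈ Θ, HasL2DerivAt P Θ θ (ℓ θ) := fun θ hθ => (hreg θ hθ).hasL2DerivAt
  have hJ : ContinuousOn (fun θ => (jacobian A θ)ᵀ) Θ :=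
    (hI_cont.mul (continuousOn_matrix_inv hG_cont hG)).congr hJA
  have hFm : ∀ θ ∈ Θ, Measurable fun x => scoreField A g p x θ := fun θ hθ =>
    measurable_scoreField hp (hg θ hθ)
  have hbdd' : ∀ x, ∀ C' : Set (Euc d), IsCompact C' → C' ⊆ Θ →
      ∃ M : ℝ, ∀ θ ∈ C', DifferentiableAt ℝ (g x) θ → ‖fderiv ℝ (g x) θ‖ ≤ M := by
    intro x C' hC' hC'Θ
    obtain ⟨M, hM⟩ := hbdd {x} isCompact_singleton C' hC' hC'Θ
    exact ⟨M, hM x rfl⟩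
  have hscore : ∀ θ ∈ Θ, ∀ᵐ x ∂(P θ), ℓ θ x = scoreField A g p x θ := fun θ hθ => by
    simp only [scoreField, hJA θ hθ]
    exact score_eq_of_isEfficient hΘ_open hP hg hp hreg hunb heff hG hbdd' hI_cont hG_cont hθ
  have hprob := hP θ₀ hθ₀
  -- Mutual absolute continuity is an equivalence relation that holds locally, so on a connected set
  -- it has one class.
  have hequiv : ∀ θ ∈ Θ, P θ ≪ P θ₀ ∧ P θ₀ ≪ P θ := fun θ hθ =>
    hΘ_conn.isPreconnected.induction₂ (fun a b => P b ≪ P a ∧ P a ≪ P b)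
      (fun η hη => by
        obtain ⟨U, hU, hUΘ, hUd, -⟩ := (hreg η hη).exists_nhds
        refine (eventually_mutually_absolutelyContinuous hP hL hFm hscore hη hU
          ?_).filter_mono nhdsWithin_le_nhds
        filter_upwards [hUd η (mem_of_mem_nhds hU)] with x hx
        exact continuousOn_scoreField (hJ.mono hUΘ)
          fun ζ hζ => (hx ζ hζ).continuousAt.continuousWithinAt)
      (fun a b c _ _ _ h1 h2 => ⟨h2.1.trans h1.1, h1.2.trans h2.2⟩)
      (fun a b _ _ h => ⟨h.2, h.1⟩) hθ₀ hθ
  have hFc : ∀ᵐ x ∂(P θ₀), ContinuousOn (scoreField A g p x) Θ := by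
    -- Differentiability of `g x` fails off a null set for each neighbourhood; a countable subcover
    -- of `Θ` leaves a single `P θ₀`-null set.
    choose! U hU hUΘ hUd _ using fun θ hθ => (hreg θ hθ).exists_nhds
    obtain ⟨T, hTΘ, hTc, hT⟩ := TopologicalSpace.countable_cover_nhdsWithin
      (f := U) fun θ hθ => mem_nhdsWithin_of_mem_nhds (hU θ hθ)
    have hdiff : ∀ᵐ x ∂(P θ₀), ∀ θ ∈ T, ∀ η ∈ U θ, DifferentiableAt ℝ (g x) η :=
      (ae_ball_iff hTc).2 fun θ hθ => (hequiv θ (hTΘ hθ)).2.ae_le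
        (hUd θ (hTΘ hθ) θ (mem_of_mem_nhds (hU θ (hTΘ hθ))))
    filter_upwards [hdiff] with x hx
    refine continuousOn_scoreField hJ fun η hη => ?_
    obtain ⟨θ, hθ, hηθ⟩ := Set.mem_iUnion₂.1 (hT hη)
    exact (hx θ hθ η hηθ).continuousAt.continuousWithinAt
  obtain ⟨D₀, hD₀c, hD₀⟩ := TopologicalSpace.exists_countable_dense (Euc d)
  set D : Set (Euc d) := Θ ∩ D₀ with hD
  have hDc : D.Countable := hD₀c.mono Set.inter_subset_right
  have hDΘ : Θ ⊆ closure D := hD₀.open_subset_closure_inter hΘ_open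
  let h : X → Euc d → ℝ := fun x θ => Real.log ((P θ).rnDeriv (P θ₀) x).toReal
  -- One null set serves all `q ∈ D`, but it depends on `θ`. For `θ ∈ D` countably many are merged
  -- to build the potential; for other `θ` the identity shows that the potential is still the
  -- log-likelihood almost everywhere.
  have hincr : ∀ θ, ∀ᵐ x ∂(P θ₀), ∀ q ∈ D, segment ℝ q θ ⊆ Θ →
      h x θ - h x q = lineIntegral (scoreField A g p x) q θ := fun θ =>
    (ae_ball_iff hDc).2 fun q _ => eventually_imp_distrib_left.2 fun hseg =>
      log_rnDeriv_sub_eq_lineIntegral hP hequiv hL hFm hFc hscore hseg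
  have hpot : ∀ᵐ x ∂(P θ₀), (∀ θ ∈ Θ, HasGradientAt (extendFrom D (h x))
      (scoreField A g p x θ) θ) ∧ ∀ θ ∈ Θ, (∀ q ∈ D, segment ℝ q θ ⊆ Θ →
      h x θ - h x q = lineIntegral (scoreField A g p x) q θ) →
      extendFrom D (h x) θ = h x θ := by
    filter_upwards [hFc, (ae_ball_iff hDc).2 fun θ _ => hincr θ] with x hx hxD
    exact potential_of_dense hΘ_open hDΘ hx fun q hq q' hq' => hxD q' hq' q hq
  have hgrad : ∀ x, (∀ θ ∈ Θ, HasGradientAt (extendFrom D (h x)) (scoreField A g p x θ) θ) →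
      ∀ θ ∈ Θ, HasGradientAt (fun θ => ⟪A θ, p x⟫ - extendFrom D (h x) θ)
        (WithLp.toLp 2 ((jacobian A θ)ᵀ *ᵥ (g x θ).ofLp)) θ := by
    intro x hx θ hθ
    have h1 := (hasGradientAt_inner_const (hA θ hθ) (p x)).hasFDerivAt.sub
      (hx θ hθ).hasFDerivAt
    have e : WithLp.toLp 2 ((jacobian A θ)ᵀ *ᵥ (p x).ofLp) - scoreField A g p x θ
        = WithLp.toLp 2 ((jacobian A θ)ᵀ *ᵥ (g x θ).ofLp) := by
      simp [scoreField, ← WithLp.toLp_sub, Matrix.mulVec_sub]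
    rw [← map_sub, e] at h1
    exact hasGradientAt_iff_hasFDerivAt.2 h1
  -- The value `0` at exceptional `x` secures differentiability of `B x` for every `x`.
  refine ⟨fun x => if ∀ θ ∈ Θ, HasGradientAt (extendFrom D (h x)) (scoreField A g p x θ) θ then
    fun θ => ⟪A θ, p x⟫ - extendFrom D (h x) θ else 0, fun x θ hθ => ?_, fun θ hθ => ?_, ?_⟩
  · dsimp only
    split_ifs with hx
    · exact (hgrad x hx θ hθ).differentiableAt
    · exact differentiableAt_const 0
  · refine ⟨(hequiv θ hθ).1, ?_⟩
    have := hP θ hθ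
    filter_upwards [hpot, hincr θ, Measure.rnDeriv_pos' (hequiv θ hθ).2,
      Measure.rnDeriv_lt_top (P θ) (P θ₀)] with x hx hxθ hpos hlt
    rw [if_pos hx.1, sub_sub_cancel, hx.2 θ hθ hxθ,
      Real.exp_log (ENNReal.toReal_pos hpos.ne' hlt.ne), ENNReal.ofReal_toReal hlt.ne]
  · filter_upwards [hpot] with x hx
    rw [if_pos hx.1]
    exact hgrad x hx.1
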